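/- Let $N_1>1$ be a square-free integer and let $N$ be the discriminant of $\mathbb{Q}(\sqrt{N_1})$, so $N=N_1$ if $N_1\equiv 1 \pmod 4$ and $N=4N_1$ otherwise. Let $\chi_D=\left(\frac{N}{\cdot}\right)$ be the Kronecker symbol. For a prime $p\mid N$ let $\chi_p$ be the $p$-component of $\chi_D$: $\chi_p=\left(\frac{\cdot}{p}\right)$ if $p$ is odd, and $\chi_2=\left(\frac{-4}{\cdot}\right),\left(\frac{2}{\cdot}\right),\left(\frac{-2}{\cdot}\right)$ according as $N_1\equiv 3 \pmod 4$, $N_1\equiv 2\pmod 8$, $N_1\equiv 6\pmod 8$. Put $\epsilon_p=\chi_p(-1)$ if $p$ is odd, $\epsilon_2=-1$ if $N_1\equiv 3\pmod 4$, and $\epsilon_2=\prod_{p\mid N_1/2}\chi_p(-1)$ if $N_1\equiv 2\pmod 4$. Let $A(N,0,\chi_D)$ be the space of holomorphic functions $f$ on the upper half plane that satisfy $f\left(\frac{a\tau+b}{c\tau+d}\right)=\chi_D(d)f(\tau)$ for all $\begin{pmatrix}a&b\\c&d\end{pmatrix}\in\Gamma_0(N)$ and are meromorphic at all cusps. Let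 $A^{\epsilon}(N,0,\chi_D)$ be the subspace of those $f=\sum_{n} a(n)q^n$, $q=e^{2\pi i\tau}$, such that $a(n)=0$ whenever $\gcd(n,N)=1$ and $\chi_p(n)=-\epsilon_p$ for some prime $p\mid N$. For $m\ge 1$ let $s(m)=2^{\omega(\gcd(m,N))}$, where $\omega(r)$ is the number of distinct prime divisors of $r$. Then for every integer $m\ge 1$ there is at most one $f_m\in A^{\epsilon}(N,0,\chi_D)$ of the form $f_m=\frac{1}{s(m)}q^{-m}+O(1)$, that is, whose coefficients at negative powers of $q$ all vanish except that of $q^{-m}$, which is $\frac{1}{s(m)}$. Moreover, if $f\in A^{\epsilon}(N,0,\chi_D)$ is holomorphic at $\infty$, that is, has $a(n)=0$ for all $n<0$, then $f=0$. -/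

import Mathlib

open UpperHalfPlane
open scoped Manifold ModularForm MatrixGroups

noncomputable section

namespace WeaklyHolomorphic

/-- The discriminant `N` of the real quadratic field `ℚ(√N₁)`, for `N₁ > 1` square-free. -/
def quadDisc (N₁ : ℕ) : ℕ := if N₁ % 4 = 1 then N₁ else 4 * N₁

/-- The Kronecker symbol `(a / n)` for integers `a`, `n`: the sign part, times the power of
`(a / 2)` (which is `0` for even `a`, `1` for `a ≡ ±1 mod 8` and `-1` for `a ≡ ±3 mod 8`),
times the Jacobi symbol at the odd part of `n`; moreover `(a / 0)` is `1` if `a = ±1`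
and `0` otherwise. -/
def kroneckerSym (a n : ℤ) : ℤ :=
  if n = 0 then (if a.natAbs = 1 then 1 else 0)
  else (if n < 0 ∧ a < 0 then -1 else 1)
    * (ZMod.χ₈ (a : ZMod 8)) ^ (n.natAbs.factorization 2)
    * jacobiSym a (n.natAbs / 2 ^ (n.natAbs.factorization 2))

/-- The character `χ_D = (N / ·)`, where `N` is the discriminant of `ℚ(√N₁)`. -/
def chiD (N₁ : ℕ) (d : ℤ) : ℤ := kroneckerSym (quadDisc N₁ : ℤ) d

/-- The `p`-component `χ_p` of `χ_D`, for a prime `p ∣ N`. For odd `p` it is `(· / p)`; for `p = 2`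
it is `(-4 / ·)` if `N₁ ≡ 3 mod 4`, `(2 / ·)` if `N₁ ≡ 2 mod 8` and `(-2 / ·)` if `N₁ ≡ 6 mod 8`
(these are `ZMod.χ₄`, `ZMod.χ₈`, `ZMod.χ₈'`). -/
def chiP (N₁ p : ℕ) (n : ℤ) : ℤ :=
  if p = 2 then
    if N₁ % 4 = 3 then ZMod.χ₄ (n : ZMod 4)
    else if N₁ % 8 = 2 then ZMod.χ₈ (n : ZMod 8)
    else ZMod.χ₈' (n : ZMod 8)
  else jacobiSym n p

/-- `χ_m = ∏_{p ∣ m} χ_p`. -/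
def chiM (N₁ m : ℕ) (n : ℤ) : ℤ := ∏ p ∈ m.primeFactors, chiP N₁ p n

/-- The sign `ε_p`, for a prime `p ∣ N`: `χ_p(-1)` if `p` is odd; for `p = 2` it is `-1` if
`N₁ ≡ 3 mod 4` and `χ_{N₁/2}(-1)` if `N₁ ≡ 2 mod 4`. -/
def eps (N₁ p : ℕ) : ℤ :=
  if p = 2 then
    if N₁ % 4 = 3 then -1 else chiM N₁ (N₁ / 2) (-1)
  else chiP N₁ p (-1)

/-- `s(m) = 2 ^ ω((m, N))`, with `ω` the number of distinct prime divisors. -/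
def sFactor (N₁ : ℕ) (m : ℤ) : ℕ := 2 ^ (Int.gcd m (quadDisc N₁ : ℤ)).primeFactors.card

/-- `f = ∑_{n ∈ ℤ} a(n) q^{n/h}` on the whole upper half plane, where `q^{n/h} = e^{2πi n τ / h}`. -/
def HasQExpansion (h : ℕ) (f : ℍ → ℂ) (a : ℤ → ℂ) : Prop :=
  ∀ τ : ℍ, HasSum
    (fun n : ℤ => a n * Complex.exp (2 * Real.pi * Complex.I * n * (τ : ℂ) / h)) (f τ)

/-- `g` is meromorphic at `i∞`: for some `h ≥ 1` it has an expansion in powers of `q^{1/h}`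
with at most finitely many terms of negative exponent. -/
def MeromorphicAtInfty (g : ℍ → ℂ) : Prop :=
  ∃ h : ℕ, 0 < h ∧ ∃ a : ℤ → ℂ, HasQExpansion h g a ∧ ∃ n₀ : ℤ, ∀ n < n₀, a n = 0

/-- `A(N, k, χ)`: the weakly holomorphic modular forms of level `N`, weight `k` and character `χ`,
i.e. the holomorphic functions on the upper half plane with `f|_k M = χ(d) f` for all
`M ∈ Γ₀(N)` that are meromorphic at all cusps. -/
structure IsWeaklyHolomorphic (N : ℕ) (k : ℤ) (χ : ℤ → ℤ) (f : ℍ → ℂ) : Prop where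
  holo : MDifferentiable 𝓘(ℂ) 𝓘(ℂ) f
  slash : ∀ M ∈ CongruenceSubgroup.Gamma0 N, ∀ τ : ℍ, (f ∣[k] M) τ = (χ (M 1 1) : ℂ) * f τ
  cusps : ∀ M : SL(2, ℤ), MeromorphicAtInfty (f ∣[k] M)

/-- The subspace `A^δ(N, k, χ_D)` of `A(N, k, χ_D)`: the forms `f = ∑ a(n) q^n` with `a(n) = 0`
whenever `(n, N) = 1` and `χ_p(n) = -δ_p` for some prime `p ∣ N`. -/
structure MemADelta (N₁ : ℕ) (k : ℤ) (δ : ℕ → ℤ) (f : ℍ → ℂ) : Prop where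
  weaklyHolomorphic : IsWeaklyHolomorphic (quadDisc N₁) k (chiD N₁) f
  condition : ∃ a : ℤ → ℂ, HasQExpansion 1 f a ∧
    ∀ n : ℤ, Int.gcd n (quadDisc N₁ : ℤ) = 1 →
      (∃ p ∈ (quadDisc N₁).primeFactors, chiP N₁ p n = -δ p) → a n = 0

/-- `f = P(q⁻¹) + O(1)` at `i∞`, where `P(q⁻¹) = ∑_{n < 0} c(n) q^n`; only the values of `c` at
negative integers matter. -/
def HasPrincipalPart (f : ℍ → ℂ) (c : ℤ → ℂ) : Prop :=
  ∃ a : ℤ → ℂ, HasQExpansion 1 f a ∧ ∀ n < 0, a n = c n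

/-- `f` is holomorphic at the cusp `∞`: its `q`-expansion has no terms of negative exponent. -/
def HolomorphicAtInfty (f : ℍ → ℂ) : Prop :=
  ∃ a : ℤ → ℂ, HasQExpansion 1 f a ∧ ∀ n < 0, a n = 0

/-- `f` is a form `f_m`: it lies in `A^ε(N, 0, χ_D)` and `f = (1/s(m)) q^{-m} + O(1)`. -/
structure IsFm (N₁ m : ℕ) (f : ℍ → ℂ) : Prop where
  mem : MemADelta N₁ 0 (eps N₁) f
  principalPart : HasPrincipalPart f (fun n => if n = -(m : ℤ) then 1 / (sFactor N₁ m : ℂ) else 0)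

end WeaklyHolomorphic

end

/-! Put `k(τ) = f(τ / N)`. Conjugation turns Γ₀(N) into the matrices with `N ∣ b`, so up to a value
of `χ_D` the function `act γ k` depends only on the first row of `γ` mod `N`. Let `V` be the span of
the integer translates of `k`. If `V` is stable under SL(2, ℤ), then every `act γ k` is a
combination of translates of `k`, hence bounded at infinity once `f` is holomorphic at `∞`. So `k`
is a modular form of weight zero on Γ(N), hence constant, and the nontrivial character forces it to
be zero. Uniqueness of `f_m` follows by taking differences.

For stability it suffices to treat, for each prime `p ∣ N`, a partial inversion: a matrix that is an
inversion modulo the `p`-part of `N` and trivial modulo the rest (`stable_of_partialInversion`). It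
sends the translate of `k` by `j` to a multiple of a translate when `p ∤ j`. For `p ∣ j` the sign
condition enters: vanishing of the coefficients with `χ_p(n) = -ε_p` is, by Fourier inversion mod
the `p`-part, a linear relation between translates. For odd `p` it rewrites `k` through translates
by integers prime to `p`; for `p = 2` it does so only for `k - k(τ + N/2)`, and the sign `χ_D(1 +
N/2) = -1` supplies the rest (`act_partialInversion_stable_two`).

The condition is given only for `n` prime to `N`. It extends to `n` sharing factors with `N` because
a combination of translates whose expansion lives on multiples of a prime `l` is killed by the
primitivity of `χ_D` at `l` (`eq_zero_of_invariant`, `hasQExpansion_zero`). -/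

noncomputable section

/-! ### The weight zero action and unipotent matrices -/

namespace WeaklyHolomorphic

/-- The weight zero right action of `SL(2, ℤ)` on functions on the upper half plane. -/
def act (γ : SL(2, ℤ)) : (ℍ → ℂ) →ₗ[ℂ] (ℍ → ℂ) := LinearMap.funLeft ℂ ℂ (fun τ : ℍ => γ • τ)

lemma act_apply (γ : SL(2, ℤ)) (k : ℍ → ℂ) (τ : ℍ) : act γ k τ = k (γ • τ) := rfl

lemma act_mul (γ δ : SL(2, ℤ)) (k : ℍ → ℂ) : act (γ * δ) k = act δ (act γ k) := by
  funext τ; simp [act_apply, mul_smul]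

@[simp] lemma act_one (k : ℍ → ℂ) : act 1 k = k := by
  funext τ; simp [act_apply]

/-- The upper unipotent matrix with entry `t`. -/
def upper (t : ℤ) : SL(2, ℤ) := ⟨!![1, t; 0, 1], by simp [Matrix.det_fin_two]⟩

/-- The lower unipotent matrix with entry `c`. -/
def lower (c : ℤ) : SL(2, ℤ) := ⟨!![1, 0; c, 1], by simp [Matrix.det_fin_two]⟩

section entries

variable (t c : ℤ) (γ δ : SL(2, ℤ))

@[simp] lemma upper_00 : upper t 0 0 = 1 := rfl
@[simp] lemma upper_01 : upper t 0 1 = t := rfl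
@[simp] lemma upper_10 : upper t 1 0 = 0 := rfl
@[simp] lemma upper_11 : upper t 1 1 = 1 := rfl
@[simp] lemma lower_00 : lower c 0 0 = 1 := rfl
@[simp] lemma lower_01 : lower c 0 1 = 0 := rfl
@[simp] lemma lower_10 : lower c 1 0 = c := rfl
@[simp] lemma lower_11 : lower c 1 1 = 1 := rfl

lemma sl_mul_apply (i j : Fin 2) : (γ * δ) i j = γ i 0 * δ 0 j + γ i 1 * δ 1 j := by
  rw [Matrix.SpecialLinearGroup.coe_mul, Matrix.mul_apply, Fin.sum_univ_two]

lemma sl_det : γ 0 0 * γ 1 1 - γ 0 1 * γ 1 0 = 1 := by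
  rw [← Matrix.det_fin_two]; exact γ.2

lemma sl_inv_00 : γ⁻¹ 0 0 = γ 1 1 := by
  rw [Matrix.SpecialLinearGroup.SL2_inv_expl]; rfl
lemma sl_inv_01 : γ⁻¹ 0 1 = -γ 0 1 := by
  rw [Matrix.SpecialLinearGroup.SL2_inv_expl]; rfl
lemma sl_inv_10 : γ⁻¹ 1 0 = -γ 1 0 := by
  rw [Matrix.SpecialLinearGroup.SL2_inv_expl]; rfl
lemma sl_inv_11 : γ⁻¹ 1 1 = γ 0 0 := by
  rw [Matrix.SpecialLinearGroup.SL2_inv_expl]; rfl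

end entries

lemma upper_mul (s t : ℤ) : upper s * upper t = upper (s + t) := by
  ext i j; fin_cases i <;> fin_cases j <;> simp [sl_mul_apply, add_comm]

@[simp] lemma upper_zero : upper 0 = 1 := by
  ext i j; fin_cases i <;> fin_cases j <;> simp

lemma act_upper_apply (t : ℤ) (k : ℍ → ℂ) (τ : ℍ) : act (upper t) k τ = k ((t : ℝ) +ᵥ τ) := by
  rw [act_apply]
  congr 1
  ext
  rw [UpperHalfPlane.coe_specialLinearGroup_apply]
  simp [add_comm]

/-! ### Eigenfunctions and the span of their translates -/

/-- A nonzero function which is an eigenfunction, with eigenvalue `χ(d)`, of all matrices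
`(a, b; c, d)` with `N ∣ b`. -/
structure IsEigen (N : ℕ) (χ : ℤ → ℤ) (k : ℍ → ℂ) : Prop where
  ne_zero : k ≠ 0
  eig : ∀ M : SL(2, ℤ), (N : ℤ) ∣ M 0 1 → act M k = (χ (M 1 1) : ℂ) • k

namespace IsEigen

variable {N : ℕ} {χ : ℤ → ℤ} {k : ℍ → ℂ}

lemma smul_inj (h : IsEigen N χ k) {a b : ℤ} (hab : (a : ℂ) • k = (b : ℂ) • k) : a = b := by
  have := smul_left_injective ℂ h.ne_zero hab
  exact_mod_cast this

lemma chi_mul_chi (h : IsEigen N χ k) (M : SL(2, ℤ)) (hM : (N : ℤ) ∣ M 0 1) :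
    χ (M 0 0) * χ (M 1 1) = 1 := by
  have h1 := h.eig M hM
  have h2 := h.eig M⁻¹ (by rw [sl_inv_01]; exact (dvd_neg).2 hM)
  have h3 : act (M⁻¹ * M) k = k := by simp
  rw [act_mul, h2, map_smul, h1, sl_inv_11, smul_smul] at h3
  apply h.smul_inj
  push_cast
  rw [h3, one_smul]

/-- `M` and `M⁻¹` have inverse eigenvalues, and integers with product 1 are equal signs. So the
character can be read off at either diagonal entry. -/
lemma chi_eq (h : IsEigen N χ k) (M : SL(2, ℤ)) (hM : (N : ℤ) ∣ M 0 1) :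
    χ (M 0 0) = χ (M 1 1) := by
  rcases Int.mul_eq_one_iff_eq_one_or_neg_one.1 (h.chi_mul_chi M hM) with h | h <;> rw [h.1, h.2]

lemma eig' (h : IsEigen N χ k) (M : SL(2, ℤ)) (hM : (N : ℤ) ∣ M 0 1) :
    act M k = (χ (M 0 0) : ℂ) • k := by
  rw [h.chi_eq M hM, h.eig M hM]

/-- Here `χ` is only a function; its periodicity comes from `k ≠ 0`. The matrix `lower j` fixes `k`,
and multiplying by it on the right moves the upper left entry from `a` to `a + N * j`. -/
lemma chi_add_mul (h : IsEigen N χ k) {a : ℤ} (ha : IsCoprime a N) (j : ℤ) :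
    χ (a + N * j) = χ a := by
  obtain ⟨x, y, hxy⟩ := ha
  let M : SL(2, ℤ) := ⟨!![a, N; -y, x], by rw [Matrix.det_fin_two_of]; linarith⟩
  have h1 := h.eig' M (by change (N : ℤ) ∣ N; rfl)
  have h2 := h.eig' (M * lower j) (by
    rw [sl_mul_apply]; change (N : ℤ) ∣ a * 0 + N * 1; simp)
  have h3 := h.eig' (lower j) (by simp)
  have h4 := h.eig (lower 0) (by simp)
  have h5 := h.eig (lower j) (by simp)
  have h6 : lower 0 = 1 := by ext i j; fin_cases i <;> fin_cases j <;> simp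
  rw [h6, act_one] at h4
  simp only [Matrix.SpecialLinearGroup.coe_one, Matrix.one_apply_eq] at h4
  rw [lower_11, ← h4] at h5
  rw [act_mul, h1, map_smul, h5, sl_mul_apply] at h2
  refine (h.smul_inj (h2.trans ?_)).symm
  congr 3
  rw [lower_00, lower_10, mul_one]
  rfl

lemma chi_congr (h : IsEigen N χ k) {a b : ℤ} (ha : IsUnit (a : ZMod N))
    (hab : (a : ZMod N) = b) : χ a = χ b := by
  obtain ⟨j, hj⟩ := (ZMod.intCast_eq_intCast_iff_dvd_sub _ _ _).1 hab
  rw [show b = a + N * j by linarith, h.chi_add_mul]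
  exact ((ZMod.coe_int_isUnit_iff_isCoprime a N).1 ha).symm

/-- The quotient `δ * γ⁻¹` has upper right entry divisible by `N` and upper left entry congruent to
`l`, so it acts on `k` by `χ l`. -/
lemma act_eq_smul (h : IsEigen N χ k) (γ δ : SL(2, ℤ)) (l : ℤ)
    (h0 : (δ 0 0 : ZMod N) = l * γ 0 0) (h1 : (δ 0 1 : ZMod N) = l * γ 0 1) :
    act δ k = (χ l : ℂ) • act γ k := by
  have hd : (γ 0 0 * γ 1 1 - γ 0 1 * γ 1 0 : ZMod N) = 1 := by
    exact_mod_cast congrArg (Int.cast : ℤ → ZMod N) (sl_det γ)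
  have hM : (N : ℤ) ∣ (δ * γ⁻¹) 0 1 := by
    rw [← ZMod.intCast_zmod_eq_zero_iff_dvd, sl_mul_apply, sl_inv_01, sl_inv_11]
    push_cast
    rw [h0, h1]; ring
  have h2 : (((δ * γ⁻¹) 0 0 : ℤ) : ZMod N) = l := by
    rw [sl_mul_apply, sl_inv_00, sl_inv_10]
    push_cast
    rw [h0, h1]; linear_combination (l : ZMod N) * hd
  have h3 := h.eig' _ hM
  have hu : IsUnit (((δ * γ⁻¹) 0 0 : ℤ) : ZMod N) := by
    have := congrArg (Int.cast : ℤ → ZMod N) (sl_det (δ * γ⁻¹))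
    push_cast at this
    rw [(ZMod.intCast_zmod_eq_zero_iff_dvd _ _).2 hM, zero_mul, sub_zero] at this
    exact IsUnit.of_mul_eq_one _ this
  rw [h.chi_congr hu h2] at h3
  have : act δ k = act (δ * γ⁻¹ * γ) k := by simp
  rw [this, act_mul, h3, map_smul]

lemma chi_one (h : IsEigen N χ k) : χ 1 = 1 := by
  have := h.chi_mul_chi 1 (by simp)
  have h2 := h.eig 1 (by simp)
  rw [act_one] at h2
  refine (h.smul_inj (h2.symm.trans ?_))
  simp

lemma act_eq (h : IsEigen N χ k) (γ δ : SL(2, ℤ))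
    (h0 : (δ 0 0 : ZMod N) = γ 0 0) (h1 : (δ 0 1 : ZMod N) = γ 0 1) :
    act δ k = act γ k := by
  rw [h.act_eq_smul γ δ 1 (by simpa) (by simpa), h.chi_one]; simp

/-- The span of the translates of `k`. -/
def translates (k : ℍ → ℂ) : Submodule ℂ (ℍ → ℂ) :=
  Submodule.span ℂ (Set.range fun t : ℤ => act (upper t) k)

lemma act_upper_mem (k : ℍ → ℂ) (t : ℤ) : act (upper t) k ∈ translates k := Submodule.subset_span ⟨t, rfl⟩

/-- A first row `(u, b)` with `u` a unit is `u` times `(1, u⁻¹ b)`, the first row of a translation.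
-/
lemma act_mem_of_isUnit (h : IsEigen N χ k) [NeZero N] (γ : SL(2, ℤ))
    (hγ : IsUnit (γ 0 0 : ZMod N)) :
    act γ k ∈ translates k := by
  obtain ⟨u, hu⟩ := hγ
  obtain ⟨t, ht⟩ := ZMod.intCast_surjective
    ((↑u⁻¹ : ZMod N) * ((γ 0 1 : ℤ) : ZMod N))
  rw [h.act_eq_smul (upper t) γ (γ 0 0) (by simp) (by simp [ht, ← hu])]
  exact Submodule.smul_mem _ _ (act_upper_mem k t)

lemma act_upper_stable (t : ℤ) {v : ℍ → ℂ} (hv : v ∈ translates k) :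
    act (upper t) v ∈ translates k := by
  have : translates k ≤ (translates k).comap (act (upper t)) := by
    refine Submodule.span_le.2 ?_
    rintro _ ⟨s, rfl⟩
    change act (upper t) (act (upper s) k) ∈ translates k
    rw [← act_mul, upper_mul]
    exact act_upper_mem k _
  exact this hv

end IsEigen

/-! ### Idempotents mod `N` and the effect of primitivity -/

lemma exists_idempotent {N q M : ℕ} (hN : N = q * M) (hc : Nat.Coprime q M) :
    ∃ E : ℤ, (q : ℤ) ∣ E - 1 ∧ (M : ℤ) ∣ E ∧ (q * E : ZMod N) = 0 ∧ (M * E : ZMod N) = M ∧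
      (E * E : ZMod N) = E := by
  obtain ⟨x, y, hxy⟩ := Nat.isCoprime_iff_coprime.2 hc
  have hqM : (q * M : ZMod N) = 0 := by
    rw [← Nat.cast_mul, ← hN]; simp
  have h1 : (x * q + y * M : ZMod N) = 1 := by exact_mod_cast congrArg (Int.cast : ℤ → ZMod N) hxy
  refine ⟨y * M, ⟨-x, by linarith⟩, ⟨y, by ring⟩, ?_, ?_, ?_⟩ <;> push_cast
  · linear_combination (y : ZMod N) * hqM
  · linear_combination (M : ZMod N) * h1 - x * hqM
  · linear_combination (y * M : ZMod N) * h1 - x * y * hqM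

lemma act_upper_mul_of_invariant {v : ℍ → ℂ} {D : ℤ} (hv : act (upper D) v = v) (j : ℕ) :
    act (upper (D * j)) v = v := by
  induction j with
  | zero => simp
  | succ j ih =>
    rw [show D * ((j + 1 : ℕ) : ℤ) = D * j + D by push_cast; ring, ← upper_mul, act_mul, ih, hv]

namespace IsEigen

variable {N : ℕ} {χ : ℤ → ℤ} {k : ℍ → ℂ}

/-- A combination of the translates of `k` by multiples of the `l`-part `q` of `N` that is
invariant under `τ ↦ τ + N / l` vanishes, if `χ` is primitive at `l`. -/
lemma eq_zero_of_invariant (h : IsEigen N χ k) [NeZero N] {q M D : ℕ} (hN : N = q * M)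
    (hc : Nat.Coprime q M) (hMD : M ∣ D)
    (hD : N ∣ D * q) {a : ℤ} (ha : IsUnit (a : ZMod N))
    (hχ : χ a = -1) (haD : (D : ℤ) ∣ a - 1) {ι : Type*} (s : Finset ι) (c : ι → ℂ) (t : ι → ℤ)
    {v : ℍ → ℂ} (hv : v = ∑ i ∈ s, c i • act (upper (q * t i)) k)
    (hinv : act (upper D) v = v) : v = 0 := by
  obtain ⟨E, -, -, hqE, hME, -⟩ := exists_idempotent hN hc
  obtain ⟨m, rfl⟩ := hMD
  obtain ⟨b, hb⟩ := haD
  have hDE : ((M * m : ℕ) * E : ZMod N) = (M * m : ℕ) := by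
    push_cast; linear_combination (m : ZMod N) * hME
  have hDq : ((M * m : ℕ) * q : ZMod N) = 0 := by
    exact_mod_cast (ZMod.natCast_eq_zero_iff _ _).2 hD
  set D := M * m
  have hab : (a : ZMod N) = 1 + D * b := by
    rw [show a = 1 + D * b by linarith]; push_cast; rfl
  -- The integer `i` represents `-a⁻¹`, so that the last translation, by `D * i`, cancels the first
  -- one, by `D`.
  obtain ⟨u, hu⟩ := ha
  obtain ⟨i, hi⟩ := ZMod.natCast_zmod_surjective (-(↑u⁻¹ : ZMod N))
  have hai : (a * i : ZMod N) = -1 := by rw [hi, ← hu]; simp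
  have hlow : act (lower (E * b)) v = v := by
    rw [hv, map_sum]
    refine Finset.sum_congr rfl fun j _ => ?_
    rw [map_smul, ← act_mul]
    congr 1
    refine h.act_eq _ _ ?_ ?_ <;> rw [sl_mul_apply] <;> simp
    linear_combination (t j * b : ZMod N) * hqE
  have h1 : act (upper D * lower (E * b) * upper (D * i)) v = v := by
    rw [act_mul, act_mul, hinv, hlow, act_upper_mul_of_invariant hinv]
  -- After the translation by `q * t j`, the product has first row congruent to `a * (1, q * t j)`:
  -- it acts on each term as `χ a = -1`, while each factor separately fixes `v`.
  have h2 : act (upper D * lower (E * b) * upper (D * i)) v = -v := by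
    rw [hv, map_sum, ← Finset.sum_neg_distrib]
    refine Finset.sum_congr rfl fun j _ => ?_
    rw [map_smul, ← act_mul, h.act_eq_smul (upper (q * t j)) _ a, hχ]
    · simp
    · simp only [sl_mul_apply, upper_00, upper_01, upper_10, upper_11, lower_00, lower_01,
        lower_10, lower_11]
      push_cast
      linear_combination (b : ZMod N) * hDE + (t j * b : ZMod N) * hqE - hab
    · simp only [sl_mul_apply, upper_00, upper_01, upper_10, upper_11, lower_00, lower_01,
        lower_10, lower_11]
      push_cast
      linear_combination (D * i * b : ZMod N) * hDE + (D * i * t j * b : ZMod N) * hqE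
        - (D * i + q * t j) * hab + D * hai - (t j * b : ZMod N) * hDq
  have h3 : v = -v := h1.symm.trans h2
  funext τ
  have := congrFun h3 τ
  simp only [Pi.neg_apply] at this
  exact self_eq_neg.1 this

end IsEigen

/-! ### Partial inversions and stability at one prime -/

/-- A lift of the matrix which is the inversion `(0, -1; 1, 0)` where `E ≡ 1` and trivial where
`E ≡ 0`. -/
def partialInversion (E : ℤ) : SL(2, ℤ) := upper (-E) * lower E * upper (-E)

section

variable {N : ℕ} {E : ℤ} (hE : (E * E : ZMod N) = E)
include hE

lemma partialInversion_00 : ((partialInversion E 0 0 : ℤ) : ZMod N) = 1 - E := by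
  simp only [partialInversion, sl_mul_apply, upper_00, upper_01, upper_10, lower_00, lower_01,
    lower_10, lower_11]
  push_cast
  linear_combination -hE

lemma partialInversion_01 : ((partialInversion E 0 1 : ℤ) : ZMod N) = -E := by
  simp only [partialInversion, sl_mul_apply, upper_00, upper_01, upper_11, lower_00, lower_01,
    lower_10, lower_11]
  push_cast
  linear_combination (1 + E : ZMod N) * hE

omit hE in
lemma partialInversion_10 : ((partialInversion E 1 0 : ℤ) : ZMod N) = E := by
  simp only [partialInversion, sl_mul_apply, upper_00, upper_10, upper_11, lower_00, lower_01,
    lower_10, lower_11]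
  push_cast
  ring

lemma partialInversion_11 : ((partialInversion E 1 1 : ℤ) : ZMod N) = 1 - E := by
  simp only [partialInversion, sl_mul_apply, upper_01, upper_10, upper_11, lower_00, lower_01,
    lower_10, lower_11]
  push_cast
  linear_combination -hE

lemma upper_mul_partialInversion_00 (j : ℤ) :
    (((upper j * partialInversion E) 0 0 : ℤ) : ZMod N) = 1 - E + j * E := by
  rw [sl_mul_apply]
  push_cast
  rw [partialInversion_00 hE, partialInversion_10]
  simp

lemma upper_mul_partialInversion_01 (j : ℤ) :
    (((upper j * partialInversion E) 0 1 : ℤ) : ZMod N) = -E + j * (1 - E) := by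
  rw [sl_mul_apply]
  push_cast
  rw [partialInversion_01 hE, partialInversion_11 hE]
  simp

end

namespace IsEigen

variable {N : ℕ} {χ : ℤ → ℤ} {k : ℍ → ℂ}

lemma exists_matrix {a : ℤ} (ha : IsUnit (a : ZMod N)) :
    ∃ M : SL(2, ℤ), M 0 0 = a ∧ M 0 1 = N := by
  obtain ⟨x, y, hxy⟩ := ((ZMod.coe_int_isUnit_iff_isCoprime a N).1 ha).symm
  exact ⟨⟨!![a, N; -y, x], by rw [Matrix.det_fin_two_of]; linarith⟩, rfl, rfl⟩

lemma chi_ne_zero (h : IsEigen N χ k) {a : ℤ} (ha : IsUnit (a : ZMod N)) : χ a ≠ 0 := by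
  obtain ⟨M, hM0, hM1⟩ := exists_matrix ha
  have := h.chi_mul_chi M (hM1 ▸ dvd_rfl)
  rw [hM0] at this
  exact left_ne_zero_of_mul_eq_one this

lemma chi_mul (h : IsEigen N χ k) {a b : ℤ} (ha : IsUnit (a : ZMod N))
    (hb : IsUnit (b : ZMod N)) : χ (a * b) = χ a * χ b := by
  obtain ⟨M, hM0, hM1⟩ := exists_matrix ha
  obtain ⟨M', hM0', hM1'⟩ := exists_matrix hb
  have h1 := h.eig' M (hM1 ▸ dvd_rfl)
  have h2 := h.eig' M' (hM1' ▸ dvd_rfl)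
  have h3 := h.act_eq_smul 1 (M * M') (a * b)
    (by rw [sl_mul_apply, hM0, hM0', hM1]; simp) (by rw [sl_mul_apply, hM1, hM1']; simp)
  rw [act_mul, h1, map_smul, h2, hM0, hM0', act_one, smul_smul] at h3
  refine (h.smul_inj (Eq.trans h3.symm ?_))
  push_cast; rfl

/-- The span of the translates of `k` by integers prime to `p`. -/
def coprimeTranslates (p : ℕ) (k : ℍ → ℂ) : Submodule ℂ (ℍ → ℂ) :=
  Submodule.span ℂ ((fun t : ℤ => act (upper t) k) '' {t | ¬ (p : ℤ) ∣ t})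

section

variable (h : IsEigen N χ k) [NeZero N] {p q M : ℕ} (hp : p.Prime) (hN : N = q * M)
  (hq : q ∣ p ^ q) (hpq : p ∣ q) {E : ℤ} (hE1 : (q : ℤ) ∣ E - 1) (hEM : (M : ℤ) ∣ E)
  (hEE : (E * E : ZMod N) = E)
include h hp hN hq hpq hE1 hEM hEE

-- The element is `j` modulo `q` and `1` modulo `M`. The hypothesis `q ∣ p ^ q` encodes that `q` is
-- a power of `p`.
omit h hEE [NeZero N] in
lemma isUnit_local {j : ℤ} (hj : ¬ (p : ℤ) ∣ j) :
    IsUnit ((1 - E + j * E : ℤ) : ZMod N) := by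
  rw [ZMod.coe_int_isUnit_iff_isCoprime, Int.isCoprime_iff_gcd_eq_one, Int.gcd_comm]
  refine Nat.coprime_of_dvd fun l hl h1 h2 => ?_
  rw [Int.natAbs_natCast, hN] at h2
  have h1' : (l : ℤ) ∣ 1 - E + j * E := Int.natCast_dvd.2 h1
  have hl' : Prime (l : ℤ) := Nat.prime_iff_prime_int.1 hl
  rcases (Nat.Prime.dvd_mul hl).1 h2 with h2 | h2
  · obtain rfl := (Nat.prime_dvd_prime_iff_eq hl hp).1 (hl.dvd_of_dvd_pow (h2.trans hq))
    apply hj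
    have : j = (1 - E + j * E) - (E - 1) * (j - 1) := by ring
    rw [this]
    exact dvd_sub h1' (((Int.natCast_dvd_natCast.2 hpq).trans hE1).mul_right _)
  · have h3 : (l : ℤ) ∣ E := (Int.natCast_dvd_natCast.2 h2).trans hEM
    have : (l : ℤ) ∣ 1 := by
      have h4 : (1 : ℤ) = (1 - E + j * E) - E * (j - 1) := by ring
      rw [h4]
      exact dvd_sub h1' (h3.mul_right _)
    exact hl'.not_isUnit (isUnit_of_dvd_one this)

lemma act_upper_mul_partialInversion_mem_of_not_dvd {j : ℤ} (hj : ¬ (p : ℤ) ∣ j) :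
    act (upper j * partialInversion E) k ∈ translates k := by
  apply h.act_mem_of_isUnit
  rw [upper_mul_partialInversion_00 hEE]
  exact_mod_cast isUnit_local hp hN hq hpq hE1 hEM hj

/-- A translation by `s` prime to `p` followed by one by a multiple of `p` is again a translation by
an integer prime to `p`. -/
lemma act_upper_mul_partialInversion_mem_of_mem {v : ℍ → ℂ} (hv : v ∈ coprimeTranslates p k)
    {j : ℤ} (hj : (p : ℤ) ∣ j) :
    act (upper j * partialInversion E) v ∈ translates k := by
  have : coprimeTranslates p k ≤ (translates k).comap (act (upper j * partialInversion E)) := by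
    refine Submodule.span_le.2 ?_
    rintro _ ⟨s, hs, rfl⟩
    change act (upper j * partialInversion E) (act (upper s) k) ∈ translates k
    rw [← act_mul, ← mul_assoc, upper_mul]
    refine h.act_upper_mul_partialInversion_mem_of_not_dvd hp hN hq hpq hE1 hEM hEE ?_
    rwa [dvd_add_left hj]
  exact this hv

omit [NeZero N] h hp hN hq hpq hE1 hEM hEE in
lemma act_stable_of_forall {γ : SL(2, ℤ)} (hγ : ∀ j : ℤ, act (upper j * γ) k ∈ translates k)
    {v : ℍ → ℂ} (hv : v ∈ translates k) : act γ v ∈ translates k := by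
  have : translates k ≤ (translates k).comap (act γ) := by
    refine Submodule.span_le.2 ?_
    rintro _ ⟨s, rfl⟩
    change act γ (act (upper s) k) ∈ translates k
    rw [← act_mul]
    exact hγ s
  exact this hv

/-- Stability under the partial inversion at a prime `p` with `p ∥ N`. -/
lemma act_partialInversion_stable_odd (hk : k ∈ coprimeTranslates p k) {v : ℍ → ℂ}
    (hv : v ∈ translates k) : act (partialInversion E) v ∈ translates k := by
  refine act_stable_of_forall (fun j => ?_) hv
  by_cases hj : (p : ℤ) ∣ j
  · exact h.act_upper_mul_partialInversion_mem_of_mem hp hN hq hpq hE1 hEM hEE hk hj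
  · exact h.act_upper_mul_partialInversion_mem_of_not_dvd hp hN hq hpq hE1 hEM hEE hj

end

section two

variable (h : IsEigen N χ k) [NeZero N] {q M n : ℕ} (hN : N = q * M) (hn : N = 2 * n)
  (hn2 : 2 ∣ n) (hM2 : M ∣ n)
  (hq : q ∣ 2 ^ q) (h2q : 2 ∣ q) {E : ℤ} (hE1 : (q : ℤ) ∣ E - 1) (hEM : (M : ℤ) ∣ E)
  (hqE : (q * E : ZMod N) = 0) (hME : (M * E : ZMod N) = M)
  (hEE : (E * E : ZMod N) = E) (hχ : χ (1 + n) = -1)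
include h hN hn hn2 hM2 hq h2q hE1 hEM hqE hME hEE hχ

/-- Stability under the partial inversion at the prime `2`, if `4 ∣ N`. -/
lemma act_partialInversion_stable_two (hk : k - act (upper n) k ∈ coprimeTranslates 2 k)
    {v : ℍ → ℂ} (hv : v ∈ translates k) : act (partialInversion E) v ∈ translates k := by
  refine act_stable_of_forall (fun j => ?_) hv
  by_cases hj : (2 : ℤ) ∣ j
  swap
  · exact h.act_upper_mul_partialInversion_mem_of_not_dvd Nat.prime_two hN hq h2q hE1 hEM hEE
      (by exact_mod_cast hj)
  -- The relation at `2` only controls differences of the values at `j` and `j + n`; the matching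
  -- sums are obtained below.
  have hdiff : ∀ j : ℤ, (2 : ℤ) ∣ j → act (upper j * partialInversion E) k -
      act (upper (j + n) * partialInversion E) k ∈ translates k := fun j hj => by
    have := h.act_upper_mul_partialInversion_mem_of_mem Nat.prime_two hN hq h2q hE1 hEM hEE hk
      (j := j) (by exact_mod_cast hj)
    rwa [map_sub, ← act_mul, ← mul_assoc, upper_mul, add_comm] at this
  have h2n : (2 * n : ZMod N) = 0 := by exact_mod_cast (ZMod.natCast_eq_zero_iff _ _).2 hn.dvd
  have hnE : (n * E : ZMod N) = n := by
    obtain ⟨m, rfl⟩ := hM2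
    push_cast
    linear_combination (m : ZMod N) * hME
  -- Modulo `q`, partial inversion followed by translation by `1` carries `j'` to `j' / (1 - j')`.
  -- Solving for the value `j` gives `j' = j / (1 + j)`, hence the inverse `i` of `1 + j`.
  obtain ⟨i, hi⟩ : ∃ i : ℤ, (q : ℤ) ∣ (1 + j) * i - 1 := by
    have : IsCoprime (1 + j) (q : ℤ) := by
      have h2 : IsCoprime (1 + j) ((2 : ℤ) ^ q) := by
        refine IsCoprime.pow_right ?_
        obtain ⟨m, rfl⟩ := hj
        exact ⟨1, -m, by ring⟩
      exact h2.of_isCoprime_of_dvd_right (by exact_mod_cast hq)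
    obtain ⟨x, y, hxy⟩ := this
    exact ⟨x, -y, by linarith⟩
  have hi2 : (((1 + j) * i - 1) * E : ZMod N) = 0 := by
    obtain ⟨m, hm⟩ := hi
    have := congrArg (Int.cast : ℤ → ZMod N) hm
    push_cast at this
    linear_combination (E : ZMod N) * this + m * hqE
  -- `j'` is sent to `j` by translation by `E`
  set j' : ℤ := j * (1 - E) + j * i * E with hj'
  have hj'2 : (2 : ℤ) ∣ j' := by
    rw [hj', mul_assoc, ← mul_add]; exact hj.mul_right _
  have hnj : (n * j : ZMod N) = 0 := by
    obtain ⟨m, rfl⟩ := hj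
    push_cast; linear_combination (m : ZMod N) * h2n
  have hnn : (n * n : ZMod N) = 0 := by
    obtain ⟨m, hm⟩ := hn2
    have : (n : ZMod N) = 2 * m := by exact_mod_cast congrArg (Nat.cast : ℕ → ZMod N) hm
    nth_rewrite 2 [this]
    linear_combination (m : ZMod N) * h2n
  have hu1 : IsUnit ((1 - j' * E : ℤ) : ZMod N) := by
    have := isUnit_local (N := N) Nat.prime_two hN hq h2q hE1 hEM
      (j := 1 - j') (by
        intro h3
        have := dvd_add h3 (by exact_mod_cast hj'2 : ((2 : ℕ) : ℤ) ∣ j')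
        norm_num at this)
    convert this using 2; ring
  have hun : IsUnit ((1 + n : ℤ) : ZMod N) := by
    refine IsUnit.of_mul_eq_one ((1 + n : ℤ) : ZMod N) ?_
    push_cast
    linear_combination h2n + hnn
  have hχ2 : χ ((1 - j' * E) * (1 + n)) = -χ (1 - j' * E) := by
    rw [h.chi_mul hu1 hun, hχ, mul_neg_one]
  have hnj' : (n * j' : ZMod N) = 0 := by
    rw [hj']; push_cast; linear_combination (1 - E + i * E : ZMod N) * hnj
  have hj'Z : (j' : ZMod N) = j * (1 - E) + j * i * E := by rw [hj']; push_cast; ring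
  have key : act (upper j' * partialInversion E * upper E) k =
      (χ (1 - j' * E) : ℂ) • act (upper j * partialInversion E) k := by
    apply h.act_eq_smul <;> rw [sl_mul_apply] <;> push_cast <;>
      simp only [upper_mul_partialInversion_00 hEE, upper_mul_partialInversion_01 hEE,
        upper_00, upper_01, upper_10, upper_11] <;> push_cast
    · grind
    · grind
  -- Replacing `j'` by `j' + n` multiplies the scalar of the first row by `1 + n`, whose character
  -- value is `-1`; this turns the difference into a sum.
  have key2 : act (upper (j' + n) * partialInversion E * upper E) k =
      -((χ (1 - j' * E) : ℂ) • act (upper (j + n) * partialInversion E) k) := by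
    rw [h.act_eq_smul (upper (j + n) * partialInversion E) _ ((1 - j' * E) * (1 + n)), hχ2]
    · simp
    all_goals
      rw [sl_mul_apply]
      push_cast
      simp only [upper_mul_partialInversion_00 hEE, upper_mul_partialInversion_01 hEE,
        upper_00, upper_01, upper_10, upper_11]
      push_cast
    · grind
    · grind
  have h1 := act_upper_stable E (hdiff j' hj'2)
  rw [map_sub, ← act_mul, ← act_mul, key, key2, sub_neg_eq_add, ← smul_add] at h1
  have hne : (χ (1 - j' * E) : ℂ) ≠ 0 := by
    exact_mod_cast h.chi_ne_zero hu1
  have h2 := (Submodule.smul_mem_iff _ hne).1 h1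
  have h3 := add_mem h2 (hdiff j hj)
  rw [add_add_sub_cancel, ← two_smul ℂ] at h3
  exact (Submodule.smul_mem_iff _ two_ne_zero).1 h3

end two

end IsEigen

/-! ### From partial inversions to SL(2, ℤ) -/

namespace IsEigen

variable {N : ℕ} {χ : ℤ → ℤ} {k : ℍ → ℂ}

/-- The span of the translates of `k` is stable under `γ`. -/
def Stable (k : ℍ → ℂ) (γ : SL(2, ℤ)) : Prop := ∀ v ∈ translates k, act γ v ∈ translates k

lemma Stable.mul {γ δ : SL(2, ℤ)} (hγ : Stable k γ) (hδ : Stable k δ) : Stable k (γ * δ) :=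
  fun v hv => by rw [act_mul]; exact hδ _ (hγ _ hv)

lemma stable_one : Stable k 1 := fun v hv => by rwa [act_one]

lemma stable_congr (h : IsEigen N χ k) {γ δ : SL(2, ℤ)} (hγ : Stable k γ)
    (hγδ : ∀ i j, (δ i j : ZMod N) = γ i j) : Stable k δ := by
  refine fun v hv => act_stable_of_forall (fun j => ?_) hv
  rw [h.act_eq (upper j * γ), act_mul]
  · exact hγ _ (act_upper_mem k j)
  all_goals
    rw [sl_mul_apply, sl_mul_apply]
    push_cast
    simp only [hγδ]

lemma stable_neg {γ : SL(2, ℤ)} (hγ : Stable k γ) : Stable k (-γ) := fun v hv => by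
  have : act (-γ) v = act γ v := by
    funext τ
    rw [act_apply, act_apply, ModularGroup.SL_neg_smul]
  rw [this]
  exact hγ v hv

/-- For orthogonal idempotents, the product of the partial inversions is the partial inversion at
their sum. -/
lemma exists_stable_inversion (N : ℕ) (E : ℕ → ℤ) (s : Finset ℕ)
    (hidem : ∀ p ∈ s, (E p * E p : ZMod N) = E p)
    (horth : ∀ p ∈ s, ∀ p' ∈ s, p ≠ p' → (E p * E p' : ZMod N) = 0)
    (hst : ∀ p ∈ s, Stable k (partialInversion (E p))) :
    ∃ γ : SL(2, ℤ), Stable k γ ∧ (γ 0 0 : ZMod N) = 1 - ∑ p ∈ s, (E p : ZMod N) ∧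
      (γ 0 1 : ZMod N) = - ∑ p ∈ s, (E p : ZMod N) ∧ (γ 1 0 : ZMod N) = ∑ p ∈ s, (E p : ZMod N) ∧
      (γ 1 1 : ZMod N) = 1 - ∑ p ∈ s, (E p : ZMod N) := by
  classical
  induction s using Finset.induction_on with
  | empty => exact ⟨1, stable_one, by simp⟩
  | insert p s hps ih =>
    obtain ⟨γ, hγ, h00, h01, h10, h11⟩ := ih (fun p' hp' => hidem p' (Finset.mem_insert_of_mem hp'))
      (fun p' hp' p'' hp'' => horth p' (Finset.mem_insert_of_mem hp') p''
        (Finset.mem_insert_of_mem hp''))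
      (fun p' hp' => hst p' (Finset.mem_insert_of_mem hp'))
    have hp := hidem p (Finset.mem_insert_self p s)
    have ho : (E p * ∑ p' ∈ s, (E p' : ZMod N) : ZMod N) = 0 := by
      rw [Finset.mul_sum]
      refine Finset.sum_eq_zero fun p' hp' => ?_
      exact horth p (Finset.mem_insert_self p s) p' (Finset.mem_insert_of_mem hp')
        (fun hpp => hps (hpp ▸ hp'))
    refine ⟨partialInversion (E p) * γ, (hst p (Finset.mem_insert_self p s)).mul hγ, ?_⟩
    rw [Finset.sum_insert hps]
    simp only [sl_mul_apply]
    push_cast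
    rw [partialInversion_00 hp, partialInversion_01 hp, partialInversion_10, partialInversion_11 hp,
      h00, h01, h10, h11]
    refine ⟨by ring, ?_, ?_, by ring⟩
    · linear_combination (2 : ZMod N) * ho
    · linear_combination (-2 : ZMod N) * ho

/-- `V` is stable under translations by construction, and `S⁻¹ = -S` acts as `S` does. -/
lemma stable_of_stable_S (hS : Stable k ModularGroup.S) (γ : SL(2, ℤ)) : Stable k γ := by
  have hT : ∀ t, Stable k (upper t) := fun t v hv => act_upper_stable t hv
  have hγ : γ ∈ Subgroup.closure {ModularGroup.S, ModularGroup.T} := by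
    rw [SpecialLinearGroup.SL2Z_generators]; trivial
  suffices Stable k γ ∧ Stable k γ⁻¹ from this.1
  induction hγ using Subgroup.closure_induction with
  | mem x hx =>
    rcases hx with rfl | rfl
    · refine ⟨hS, ?_⟩
      have : ModularGroup.S⁻¹ = -ModularGroup.S := by
        rw [inv_eq_iff_mul_eq_one]
        ext i j; fin_cases i <;> fin_cases j <;> simp [ModularGroup.coe_S]
      rw [this]
      exact stable_neg hS
    · have h1 : ModularGroup.T = upper 1 := rfl
      have h2 : ModularGroup.T⁻¹ = upper (-1) := by
        rw [h1, inv_eq_iff_mul_eq_one, upper_mul]; simp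
      exact ⟨h1 ▸ hT 1, h2 ▸ hT (-1)⟩
  | one => simp [stable_one]
  | mul x y _ _ hx hy => exact ⟨hx.1.mul hy.1, mul_inv_rev x y ▸ hy.2.mul hx.2⟩
  | inv x _ hx => exact ⟨hx.2, (inv_inv x).symm ▸ hx.1⟩

/-- The translates of `k` span a space stable under `SL(2, ℤ)` if they span a space stable under
the partial inversion at every prime divisor of `N`. -/
lemma stable_of_partialInversion (h : IsEigen N χ k) (hN : N ≠ 0) (E : ℕ → ℤ)
    (h1 : ∀ p ∈ N.primeFactors, ((p ^ N.factorization p : ℕ) : ℤ) ∣ E p - 1)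
    (h0 : ∀ p ∈ N.primeFactors, ((N / p ^ N.factorization p : ℕ) : ℤ) ∣ E p)
    (hidem : ∀ p ∈ N.primeFactors, (E p * E p : ZMod N) = E p)
    (hst : ∀ p ∈ N.primeFactors, Stable k (partialInversion (E p))) (γ : SL(2, ℤ)) :
    Stable k γ := by
  have hcop : ∀ p ∈ N.primeFactors, ∀ p' ∈ N.primeFactors, p ≠ p' →
      Nat.Coprime (p ^ N.factorization p) (p' ^ N.factorization p') := fun p hp p' hp' hne =>
    Nat.Coprime.pow _ _ ((Nat.coprime_primes (Nat.prime_of_mem_primeFactors hp)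
      (Nat.prime_of_mem_primeFactors hp')).2 hne)
  have hdvd : ∀ p ∈ N.primeFactors, ∀ p' ∈ N.primeFactors, p ≠ p' →
      ((p' ^ N.factorization p' : ℕ) : ℤ) ∣ E p := fun p hp p' hp' hne => by
    refine (Int.natCast_dvd_natCast.2 ?_).trans (h0 p hp)
    refine (hcop p' hp' p hp hne.symm).dvd_of_dvd_mul_left ?_
    rw [Nat.ordProj_mul_ordCompl_eq_self]
    exact Nat.ordProj_dvd N p'
  have horth : ∀ p ∈ N.primeFactors, ∀ p' ∈ N.primeFactors, p ≠ p' →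
      (E p * E p' : ZMod N) = 0 := fun p hp p' hp' hne => by
    have : (N : ℤ) ∣ E p * E p' := by
      rw [← Nat.ordProj_mul_ordCompl_eq_self N p', Nat.cast_mul]
      exact mul_dvd_mul (hdvd p hp p' hp' hne) (h0 p' hp')
    exact_mod_cast (ZMod.intCast_zmod_eq_zero_iff_dvd _ _).2 this
  -- Modulo each prime power exactly dividing `N`, one idempotent is `1` and the others are `0`. The
  -- product of all partial inversions is therefore `S` mod `N`.
  have hsum : (∑ p ∈ N.primeFactors, (E p : ZMod N)) = 1 := by
    have : (N : ℤ) ∣ ∑ p ∈ N.primeFactors, E p - 1 := by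
      nth_rewrite 1 [← Nat.prod_factorization_pow_eq_self hN]
      rw [Finsupp.prod, Nat.support_factorization, Nat.cast_prod]
      refine Finset.prod_dvd_of_coprime ?_ ?_
      · intro p hp p' hp' hne
        exact Nat.isCoprime_iff_coprime.2 (hcop p hp p' hp' hne)
      · intro p hp
        rw [← Finset.add_sum_erase _ _ hp, add_sub_right_comm]
        refine dvd_add (h1 p hp) (Finset.dvd_sum fun p' hp' => ?_)
        exact hdvd p' (Finset.mem_of_mem_erase hp') p hp (Finset.ne_of_mem_erase hp')
    have := (ZMod.intCast_zmod_eq_zero_iff_dvd _ _).2 this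
    push_cast at this
    exact sub_eq_zero.1 this
  obtain ⟨δ, hδ, h00, h01, h10, h11⟩ := exists_stable_inversion N E _ hidem horth hst
  refine stable_of_stable_S (h.stable_congr hδ ?_) γ
  rw [hsum] at h00 h01 h10 h11
  intro i j
  fin_cases i <;> fin_cases j <;> simp [ModularGroup.S, h00, h01, h10, h11]

end IsEigen

/-! ### Boundedness at the cusps and constancy -/

/-- For `n ≥ 0` the norm of the `n`-th term decreases with the imaginary part, so the absolute sum
at `I` bounds the function wherever the imaginary part is at least `1`. -/
lemma isBoundedAtImInfty_of_hasQExpansion {N : ℕ} (hN : 0 < N) {k : ℍ → ℂ} {a : ℤ → ℂ}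
    (hk : HasQExpansion N k a) (ha : ∀ n < 0, a n = 0) : IsBoundedAtImInfty k := by
  have hexp : ∀ (τ : ℍ) (n : ℤ), ‖a n * Complex.exp (2 * Real.pi * Complex.I * n * (τ : ℂ) / N)‖
      = ‖a n‖ * Real.exp (-(2 * Real.pi * n * τ.im / N)) := fun τ n => by
    rw [norm_mul, Complex.norm_exp]
    congr 2
    rw [show (2 * Real.pi * Complex.I * n * (τ : ℂ) / N : ℂ) =
      ((2 * Real.pi * n / N : ℝ) : ℂ) * (Complex.I * τ) by push_cast; ring, Complex.re_ofReal_mul]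
    simp
    ring
  have hsum := (hk I).summable.norm
  rw [isBoundedAtImInfty_iff]
  refine ⟨∑' n : ℤ, ‖a n * Complex.exp (2 * Real.pi * Complex.I * n * (I : ℂ) / N)‖, 1,
    fun τ hτ => ?_⟩
  rw [← (hk τ).tsum_eq]
  refine (norm_tsum_le_tsum_norm (hk τ).summable.norm).trans
    ((hk τ).summable.norm.tsum_le_tsum (fun n => ?_) hsum)
  rw [hexp, hexp]
  rcases lt_or_ge n 0 with hn | hn
  · simp [ha n hn]
  · gcongr
    simpa using hτ

lemma isBoundedAtImInfty_act_upper {k : ℍ → ℂ} (hk : IsBoundedAtImInfty k) (t : ℤ) :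
    IsBoundedAtImInfty (act (upper t) k) := by
  rw [isBoundedAtImInfty_iff] at hk ⊢
  obtain ⟨B, A, hA⟩ := hk
  refine ⟨B, A, fun τ hτ => ?_⟩
  rw [act_upper_apply]
  exact hA _ (by simpa using hτ)

lemma isBoundedAtImInfty_of_mem_translates {k v : ℍ → ℂ} (hk : IsBoundedAtImInfty k)
    (hv : v ∈ IsEigen.translates k) : IsBoundedAtImInfty v := by
  induction hv using Submodule.span_induction with
  | mem x hx => obtain ⟨t, rfl⟩ := hx; exact isBoundedAtImInfty_act_upper hk t
  | zero => exact zero_form_isBoundedAtImInfty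
  | add x y _ _ hx hy => exact hx.add hy
  | smul c x _ hx => exact hx.const_smul_left c

/-- An eigenfunction of level `N` whose `SL(2, ℤ)`-translates are bounded at infinity is
constant. -/
lemma IsEigen.exists_eq_const {N : ℕ} [NeZero N] {χ : ℤ → ℤ} {k : ℍ → ℂ} (h : IsEigen N χ k)
    (hol : MDifferentiable 𝓘(ℂ) 𝓘(ℂ) k) (hb : ∀ γ : SL(2, ℤ), IsBoundedAtImInfty (act γ k)) :
    ∃ c, k = Function.const ℍ c := by
  have hslash : ∀ γ : SL(2, ℤ), k ∣[(0 : ℤ)] γ = act γ k := fun γ => by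
    funext τ
    rw [ModularForm.SL_slash_apply, act_apply]; simp
  exact ModularForm.eq_const_of_weight_zero (𝒢 := (CongruenceSubgroup.Gamma N)) {
    toFun := k
    holo' := hol
    slash_action_eq' := by
      rintro _ ⟨γ, hγ, rfl⟩
      have := hslash γ
      rw [ModularForm.SL_slash] at this
      refine this.trans ?_
      have h2 := CongruenceSubgroup.Gamma_mem.1 hγ
      -- An element of Γ(N) has first row congruent to `(1, 0)`, so it fixes `k`.
      rw [h.act_eq 1 γ (by simp [h2.1]) (by simp [h2.2.1]), act_one]
    bdd_at_cusps' := by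
      intro c hc
      rw [Subgroup.IsArithmetic.isCusp_iff_isCusp_SL2Z] at hc
      rw [OnePoint.isBoundedAt_iff_forall_SL2Z hc]
      intro γ hγ
      rw [hslash]
      exact hb γ }

/-! ### Expansions and Fourier multipliers -/

namespace HasQExpansion

variable {N : ℕ} {k k' : ℍ → ℂ} {a b : ℤ → ℂ}

lemma unique (h : HasQExpansion N k a) (h' : HasQExpansion N k' a) : k = k' :=
  funext fun τ => (h τ).unique (h' τ)

lemma sub (h : HasQExpansion N k a) (h' : HasQExpansion N k' b) :
    HasQExpansion N (k - k') (fun n => a n - b n) := fun τ => by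
  simp only [sub_mul]
  exact (h τ).sub (h' τ)

lemma act_upper (hN : N ≠ 0) (h : HasQExpansion N k a) (t : ℤ) :
    HasQExpansion N (act (upper t) k)
      (fun n => Complex.exp (2 * Real.pi * Complex.I * (n * t : ℤ) / N) * a n) := fun τ => by
  rw [act_upper_apply]
  convert h ((t : ℝ) +ᵥ τ) using 2 with n
  beta_reduce
  rw [mul_comm (Complex.exp _) (a n), mul_assoc, ← Complex.exp_add]
  congr 2
  have : (N : ℂ) ≠ 0 := Nat.cast_ne_zero.2 hN
  rw [coe_vadd]
  push_cast
  field_simp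

lemma sum_smul {ι : Type*} (s : Finset ι) (c : ι → ℂ) {f : ι → ℍ → ℂ} {b : ι → ℤ → ℂ}
    (h : ∀ i ∈ s, HasQExpansion N (f i) (b i)) :
    HasQExpansion N (∑ i ∈ s, c i • f i) (fun n => ∑ i ∈ s, c i * b i n) := fun τ => by
  have := hasSum_sum (fun i hi => (h i hi τ).mul_left (c i))
  simp only [Finset.sum_apply, Pi.smul_apply, smul_eq_mul, Finset.sum_mul]
  simpa only [mul_assoc (c _)] using this

open scoped ZMod in
/-- A multiplier of the coefficients that is periodic mod `m` is a combination of translations. -/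
lemma fourier_multiplier {m r : ℕ} [NeZero m] (hN : N ≠ 0) (hm : N = m * r)
    (h : HasQExpansion N k a) (μ : ZMod m → ℂ) :
    HasQExpansion N (∑ j : ZMod m, ((m : ℂ)⁻¹ * ZMod.dft μ j) • act (upper (r * (j.val : ℤ))) k)
      (fun n => μ n * a n) := by
  have h1 := sum_smul Finset.univ (fun j : ZMod m => (m : ℂ)⁻¹ * ZMod.dft μ j)
    (fun j _ => h.act_upper hN (r * (j.val : ℤ)))
  convert h1 using 1
  funext n
  simp_rw [← mul_assoc, ← Finset.sum_mul]
  congr 1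
  have h2 : μ n = ZMod.dft.symm (ZMod.dft μ) (n : ZMod m) := by simp
  rw [h2, ZMod.invDFT_apply, smul_eq_mul, Finset.mul_sum]
  refine Finset.sum_congr rfl fun j _ => ?_
  rw [smul_eq_mul, mul_comm (ZMod.stdAddChar _), mul_assoc]
  congr 2
  have h3 : (j * n : ZMod m) = ((j.val * n : ℤ) : ZMod m) := by
    push_cast; rw [ZMod.natCast_zmod_val]
  rw [h3, ZMod.stdAddChar_coe]
  congr 1
  have hm0 : (m : ℂ) ≠ 0 := Nat.cast_ne_zero.2 (NeZero.ne m)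
  have hr0 : (r : ℂ) ≠ 0 := by
    rintro h0
    rw [Nat.cast_eq_zero] at h0
    exact hN (by rw [hm, h0, mul_zero])
  rw [hm]
  push_cast
  field_simp

end HasQExpansion

/-! ### Removing the restriction to exponents prime to `N` -/

/-- The character `χ` mod `N` has full conductor at the prime `l`. -/
def PrimitiveAt (N : ℕ) (χ : ℤ → ℤ) (l : ℕ) : Prop :=
  ∃ a : ℤ, IsUnit (a : ZMod N) ∧ χ a = -1 ∧ ((N / l : ℕ) : ℤ) ∣ a - 1

namespace IsEigen

variable {N : ℕ} [NeZero N] {χ : ℤ → ℤ} {k : ℍ → ℂ} {a : ℤ → ℂ}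

/-- As `μ` has period the prime-to-`l` part of `N`, the multiplier is a combination `v` of
translates by multiples of the `l`-part. By `h0` its expansion lives on multiples of `l`, so `v` is
invariant under translation by `N / l`, and primitivity at `l` kills it. -/
lemma hasQExpansion_zero_of_coprime (h : IsEigen N χ k) (hk : HasQExpansion N k a) {l : ℕ}
    (hl : l ∈ N.primeFactors) (hχ : PrimitiveAt N χ l) (μ : ℤ → ℂ)
    (hμ : ∀ n n' : ℤ, ((N / l ^ N.factorization l : ℕ) : ℤ) ∣ n - n' → μ n = μ n')
    (h0 : HasQExpansion N 0 (fun n => (if (l : ℤ) ∣ n then 0 else μ n) * a n)) :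
    HasQExpansion N 0 (fun n => μ n * a n) := by
  have hN : N ≠ 0 := NeZero.ne N
  have hlp := Nat.prime_of_mem_primeFactors hl
  have hlN := Nat.dvd_of_mem_primeFactors hl
  obtain ⟨b, hbu, hχb, hb⟩ := hχ
  have hlq : l ∣ l ^ N.factorization l :=
    dvd_pow_self l (hlp.factorization_pos_of_dvd hN hlN).ne'
  have hqM : N = l ^ N.factorization l * (N / l ^ N.factorization l) :=
    (Nat.ordProj_mul_ordCompl_eq_self N l).symm
  have hcop : Nat.Coprime (l ^ N.factorization l) (N / l ^ N.factorization l) :=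
    (Nat.coprime_ordCompl hlp hN).pow_left _
  set q := l ^ N.factorization l
  set M := N / q
  have hM0 : NeZero M := ⟨by rintro h0; rw [h0, mul_zero] at hqM; exact hN hqM⟩
  have hD : N = l * (N / l) := (Nat.mul_div_cancel' hlN).symm
  have hDM : N / l = M * (q / l) := by
    rw [hqM, mul_comm q M, Nat.mul_div_assoc _ hlq]
  have hv := hk.fourier_multiplier hN (hqM.trans (mul_comm q M)) (fun x : ZMod M => μ x.val)
  have hμ' : ∀ n : ℤ, μ ((n : ZMod M).val : ℤ) = μ n := fun n => hμ _ _ <| by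
    rw [← ZMod.intCast_eq_intCast_iff_dvd_sub]
    simp
  simp only [hμ'] at hv
  set v := ∑ j : ZMod M, ((M : ℂ)⁻¹ * ZMod.dft (fun x : ZMod M => μ x.val) j) •
    act (upper (q * (j.val : ℤ))) k with hvdef
  have hv2 : HasQExpansion N v (fun n => (if (l : ℤ) ∣ n then μ n else 0) * a n) := by
    have := hv.sub h0
    rw [sub_zero] at this
    convert this using 2 with n
    split_ifs <;> simp
  have hinv : act (upper (N / l : ℕ)) v = v := by
    refine HasQExpansion.unique (a := fun n => (if (l : ℤ) ∣ n then μ n else 0) * a n) ?_ hv2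
    convert hv2.act_upper hN (N / l : ℕ) using 2 with n
    split_ifs with hn
    · obtain ⟨x, rfl⟩ := hn
      have : (2 * Real.pi * Complex.I * ((l * x * (N / l : ℕ) : ℤ) : ℂ) / N : ℂ) =
          x * (2 * Real.pi * Complex.I) := by
        have h1 : ((l * x * (N / l : ℕ) : ℤ) : ℂ) = x * N := by
          have h2 : (N : ℂ) = l * (N / l : ℕ) := by
            rw [← Nat.cast_mul, ← hD]
          rw [h2, Int.cast_mul, Int.cast_mul, Int.cast_natCast, Int.cast_natCast]
          ring
        rw [h1]
        have : (N : ℂ) ≠ 0 := Nat.cast_ne_zero.2 hN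
        field_simp
      rw [this, Complex.exp_int_mul_two_pi_mul_I, one_mul]
    · simp
  have hv0 : v = 0 := h.eq_zero_of_invariant hqM hcop (hDM ▸ dvd_mul_right _ _)
    (by rw [hDM, mul_right_comm, mul_comm M q, ← hqM]; exact dvd_mul_right _ _) hbu hχb hb
    Finset.univ _ _ hvdef hinv
  rwa [hv0] at hv

/-- Only the coefficients prime to `N` matter for the vanishing of the part of `k` cut out by a
condition at the prime `p`. -/
lemma hasQExpansion_zero (h : IsEigen N χ k) (hk : HasQExpansion N k a)
    (hχ : ∀ l ∈ N.primeFactors, PrimitiveAt N χ l) {p : ℕ} (hp : p ∈ N.primeFactors) (μ : ℤ → ℂ)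
    (hμ : ∀ n n' : ℤ, ((p ^ N.factorization p : ℕ) : ℤ) ∣ n - n' → μ n = μ n')
    (hμp : ∀ n : ℤ, (p : ℤ) ∣ n → μ n = 0)
    (h0 : ∀ n : ℤ, Int.gcd n N = 1 → μ n * a n = 0) :
    HasQExpansion N 0 (fun n => μ n * a n) := by
  -- The primes other than `p` are removed one at a time. With all of them in `s`, only exponents
  -- prime to `N` survive, and there `h0` applies.
  suffices ∀ s ⊆ N.primeFactors.erase p, HasQExpansion N 0
      (fun n => (if ∃ l ∈ s, (l : ℤ) ∣ n then 0 else μ n) * a n) →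
      HasQExpansion N 0 (fun n => μ n * a n) by
    refine this _ subset_rfl fun τ => ?_
    rw [Pi.zero_apply]
    convert hasSum_zero using 2 with n
    beta_reduce
    split_ifs with hn
    · simp
    · by_cases hpn : (p : ℤ) ∣ n
      · simp [hμp n hpn]
      · rw [h0 n, zero_mul]
        rw [Int.gcd_comm]
        refine Nat.coprime_of_dvd fun l hl h1 h2 => ?_
        rw [Int.natAbs_natCast] at h1
        have h2' := Int.natCast_dvd.2 h2
        by_cases hlp : l = p
        · exact hpn (hlp ▸ h2')
        · exact hn ⟨l, Finset.mem_erase.2 ⟨hlp, Nat.mem_primeFactors.2 ⟨hl, h1, NeZero.ne N⟩⟩, h2'⟩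
  intro s
  induction s using Finset.induction_on with
  | empty => intro _ h1; simpa using h1
  | insert l s hls ih =>
    intro hs h1
    refine ih ((Finset.subset_insert l s).trans hs) ?_
    have hl := Finset.mem_erase.1 (hs (Finset.mem_insert_self l s))
    have hlp := Nat.prime_of_mem_primeFactors hl.2
    refine h.hasQExpansion_zero_of_coprime hk hl.2 (hχ l hl.2) _ ?_ ?_
    · intro n n' hnn
      have hdvd : ∀ p' ∈ N.primeFactors, p' ≠ l →
          p' ^ N.factorization p' ∣ N / l ^ N.factorization l := fun p' hp' hne => by
        have hc : Nat.Coprime (p' ^ N.factorization p') (l ^ N.factorization l) :=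
          Nat.Coprime.pow _ _
            ((Nat.coprime_primes (Nat.prime_of_mem_primeFactors hp') hlp).2 hne)
        refine hc.dvd_of_dvd_mul_left ?_
        rw [Nat.ordProj_mul_ordCompl_eq_self]
        exact Nat.ordProj_dvd N p'
      have h2 : μ n = μ n' :=
        hμ n n' ((Int.natCast_dvd_natCast.2 (hdvd p hp hl.1.symm)).trans hnn)
      have h3 : (∃ l ∈ s, (l : ℤ) ∣ n) ↔ ∃ l ∈ s, (l : ℤ) ∣ n' := by
        refine exists_congr fun l' => and_congr_right fun hl' => ?_
        have hl'2 := (Finset.mem_erase.1 (hs (Finset.mem_insert_of_mem hl'))).2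
        have h4 : l' ∣ N / l ^ N.factorization l :=
          (dvd_pow_self l' ((Nat.prime_of_mem_primeFactors hl'2).factorization_pos_of_dvd
            (NeZero.ne N) (Nat.dvd_of_mem_primeFactors hl'2)).ne').trans
            (hdvd l' hl'2 (fun h5 => hls (h5 ▸ hl')))
        exact (dvd_iff_dvd_of_dvd_sub ((Int.natCast_dvd_natCast.2 h4).trans hnn))
      simp only [h2, h3]
    · convert h1 using 3 with n
      by_cases hln : (l : ℤ) ∣ n <;> simp [hln]

end IsEigen

/-! ### Linear relations between translates -/

lemma sum_zmod_four {A : Type*} [AddCommMonoid A] (g : ZMod 4 → A) :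
    ∑ j, g j = g 0 + g 1 + g 2 + g 3 := Fin.sum_univ_four g

lemma sum_zmod_eight {A : Type*} [AddCommMonoid A] (g : ZMod 8 → A) :
    ∑ j, g j = g 0 + g 1 + g 2 + g 3 + g 4 + g 5 + g 6 + g 7 := Fin.sum_univ_eight g

namespace IsEigen

variable {N : ℕ} [NeZero N] {χ : ℤ → ℤ} {k : ℍ → ℂ} {a : ℤ → ℂ}

lemma sum_dft_smul_act_eq_zero (hk : HasQExpansion N k a) {q M : ℕ} [NeZero q] (hN : N = q * M)
    (ν : ZMod q → ℂ) (h0 : HasQExpansion N 0 (fun n => ν n * a n)) :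
    ∑ j : ZMod q, ((q : ℂ)⁻¹ * ZMod.dft ν j) • act (upper (M * (j.val : ℤ))) k = 0 :=
  (hk.fourier_multiplier (NeZero.ne N) hN ν).unique h0

omit [NeZero N] in
lemma act_upper_mem_coprimeTranslates {p : ℕ} {t : ℤ} (ht : ¬ (p : ℤ) ∣ t) :
    act (upper t) k ∈ coprimeTranslates p k := Submodule.subset_span ⟨t, ht, rfl⟩

/-- In the relation given by `ν`, the coefficient of `k` itself is the Fourier transform at `0`, a
nonzero multiple of `∑ j, ν j`; every other translation is prime to `p`. -/
lemma mem_coprimeTranslates_of_relation (hk : HasQExpansion N k a) {p M : ℕ} [Fact p.Prime]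
    (hN : N = p * M) (hM : Nat.Coprime p M) (ν : ZMod p → ℂ)
    (hν : ∑ j, ν j ≠ 0) (h0 : HasQExpansion N 0 (fun n => ν n * a n)) :
    k ∈ coprimeTranslates p k := by
  have hrel := sum_dft_smul_act_eq_zero hk hN ν h0
  have hp : p.Prime := Fact.out
  rw [← Finset.add_sum_erase _ _ (Finset.mem_univ 0), ZMod.dft_apply_zero] at hrel
  have hc : ((p : ℂ)⁻¹ * ∑ j, ν j) ≠ 0 :=
    mul_ne_zero (inv_ne_zero (Nat.cast_ne_zero.2 hp.ne_zero)) hν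
  rw [ZMod.val_zero, Nat.cast_zero, mul_zero, upper_zero, act_one] at hrel
  rw [← Submodule.smul_mem_iff _ hc, eq_neg_of_add_eq_zero_left hrel]
  refine neg_mem (Submodule.sum_mem _ fun j hj => Submodule.smul_mem _ _
    (act_upper_mem_coprimeTranslates ?_))
  have hj0 := Finset.ne_of_mem_erase hj
  rw [← Nat.cast_mul, Int.natCast_dvd_natCast, hM.dvd_mul_left]
  intro hd
  exact (ZMod.val_ne_zero j).2 hj0 (Nat.eq_zero_of_dvd_of_lt hd (ZMod.val_lt j))

/-- Since `ν` lives on odd classes, its transform changes sign from `0` to `2`; the even part of the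
relation is thus a multiple of the difference. -/
lemma sub_mem_coprimeTranslates_four (hk : HasQExpansion N k a) {M : ℕ}
    (hN : N = 4 * M) (hM : Odd M) (ν : ZMod 4 → ℂ) (h0 : ν 0 = 0) (h2 : ν 2 = 0)
    (h13 : ν 1 + ν 3 = 1) (hq : HasQExpansion N 0 (fun n => ν n * a n)) :
    k - act (upper (2 * M : ℕ)) k ∈ coprimeTranslates 2 k := by
  have hrel := sum_dft_smul_act_eq_zero hk hN ν hq
  have hodd : ∀ j : ℕ, Odd j → act (upper (M * (j : ℤ))) k ∈ coprimeTranslates 2 k := by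
    intro j hj
    refine act_upper_mem_coprimeTranslates ?_
    rw [← Nat.cast_mul, Int.natCast_dvd_natCast, ← even_iff_two_dvd, Nat.not_even_iff_odd]
    exact hM.mul hj
  have hm : ZMod.stdAddChar (2 : ZMod 4) = -1 := by
    have := ZMod.stdAddChar_coe (N := 4) 2
    push_cast at this
    rw [this, ← Complex.exp_pi_mul_I]
    congr 1
    ring
  have e0 : ZMod.dft ν 0 = 1 := by
    rw [ZMod.dft_apply_zero, sum_zmod_four, h0, h2]
    linear_combination h13
  have e2 : ZMod.dft ν 2 = -1 := by
    rw [ZMod.dft_apply, sum_zmod_four]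
    rw [show (-((1 : ZMod 4) * 2)) = 2 by decide, show (-((3 : ZMod 4) * 2)) = 2 by decide, hm, h0,
      h2]
    simp only [smul_eq_mul]
    linear_combination -h13
  rw [sum_zmod_four] at hrel
  change (((4 : ℕ) : ℂ)⁻¹ * ZMod.dft ν 0) • act (upper (M * ((0 : ℕ) : ℤ))) k +
    (((4 : ℕ) : ℂ)⁻¹ * ZMod.dft ν 1) • act (upper (M * ((1 : ℕ) : ℤ))) k +
    (((4 : ℕ) : ℂ)⁻¹ * ZMod.dft ν 2) • act (upper (M * ((2 : ℕ) : ℤ))) k +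
    (((4 : ℕ) : ℂ)⁻¹ * ZMod.dft ν 3) • act (upper (M * ((3 : ℕ) : ℤ))) k = 0 at hrel
  rw [e0, e2, Nat.cast_zero, mul_zero, upper_zero, act_one] at hrel
  have key : k - act (upper (2 * M : ℕ)) k = -(ZMod.dft ν 1 • act (upper (M * ((1 : ℕ) : ℤ))) k) -
      ZMod.dft ν 3 • act (upper (M * ((3 : ℕ) : ℤ))) k := by
    rw [show ((2 * M : ℕ) : ℤ) = M * ((2 : ℕ) : ℤ) by push_cast; ring]
    funext τ
    have := congrFun hrel τ
    simp only [Pi.add_apply, Pi.smul_apply, smul_eq_mul, Pi.zero_apply, Nat.cast_ofNat] at this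
    simp only [Pi.sub_apply, Pi.neg_apply, Pi.smul_apply, smul_eq_mul, Nat.cast_ofNat]
    linear_combination 4 * this
  rw [key]
  exact sub_mem (neg_mem (Submodule.smul_mem _ _ (hodd 1 (by decide))))
    (Submodule.smul_mem _ _ (hodd 3 (by decide)))

/-- The conditions on `ν` make its transform vanish at `2` and `6` and take opposite values `2` and
`-2` at `0` and `4`. Only `k` and its translate by `4 * M` remain among the even translations. -/
lemma sub_mem_coprimeTranslates_eight (hk : HasQExpansion N k a) {M : ℕ}
    (hN : N = 8 * M) (hM : Odd M) (ν : ZMod 8 → ℂ) (h0 : ν 0 = 0) (h2 : ν 2 = 0) (h4 : ν 4 = 0)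
    (h6 : ν 6 = 0) (h15 : ν 1 + ν 5 = 1) (h37 : ν 3 + ν 7 = 1)
    (hq : HasQExpansion N 0 (fun n => ν n * a n)) :
    k - act (upper (4 * M : ℕ)) k ∈ coprimeTranslates 2 k := by
  have hrel := sum_dft_smul_act_eq_zero hk hN ν hq
  have hodd : ∀ j : ℕ, Odd j → act (upper (M * (j : ℤ))) k ∈ coprimeTranslates 2 k := by
    intro j hj
    refine act_upper_mem_coprimeTranslates ?_
    rw [← Nat.cast_mul, Int.natCast_dvd_natCast, ← even_iff_two_dvd, Nat.not_even_iff_odd]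
    exact hM.mul hj
  have hm : ZMod.stdAddChar (4 : ZMod 8) = -1 := by
    have := ZMod.stdAddChar_coe (N := 8) 4
    push_cast at this
    rw [this, ← Complex.exp_pi_mul_I]
    congr 1
    ring
  have hm2 : ZMod.stdAddChar (6 : ZMod 8) = - ZMod.stdAddChar (2 : ZMod 8) := by
    rw [show (6 : ZMod 8) = 4 + 2 by decide, AddChar.map_add_eq_mul, hm, neg_one_mul]
  have hdft : ∀ x, ZMod.dft ν x = ZMod.stdAddChar (-x) * ν 1 + ZMod.stdAddChar (-(3 * x)) * ν 3 +
      ZMod.stdAddChar (-(5 * x)) * ν 5 + ZMod.stdAddChar (-(7 * x)) * ν 7 := fun x => by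
    rw [ZMod.dft_apply, sum_zmod_eight]
    rw [h0, h2, h4, h6, one_mul]
    simp only [smul_eq_mul, mul_zero, zero_add, add_zero]
  have e0 : ZMod.dft ν 0 = 2 := by
    rw [hdft]
    simp only [mul_zero, neg_zero, AddChar.map_zero_eq_one]
    linear_combination h15 + h37
  have e2 : ZMod.dft ν 2 = 0 := by
    rw [hdft, show (-(2 : ZMod 8)) = 6 by decide, show (-((3 : ZMod 8) * 2)) = 2 by decide,
      show (-((5 : ZMod 8) * 2)) = 6 by decide, show (-((7 : ZMod 8) * 2)) = 2 by decide, hm2]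
    linear_combination ZMod.stdAddChar (2 : ZMod 8) * (h37 - h15)
  have e4 : ZMod.dft ν 4 = -2 := by
    rw [hdft, show (-(4 : ZMod 8)) = 4 by decide, show (-((3 : ZMod 8) * 4)) = 4 by decide,
      show (-((5 : ZMod 8) * 4)) = 4 by decide, show (-((7 : ZMod 8) * 4)) = 4 by decide, hm]
    linear_combination -h15 - h37
  have e6 : ZMod.dft ν 6 = 0 := by
    rw [hdft, show (-(6 : ZMod 8)) = 2 by decide, show (-((3 : ZMod 8) * 6)) = 6 by decide,
      show (-((5 : ZMod 8) * 6)) = 2 by decide, show (-((7 : ZMod 8) * 6)) = 6 by decide, hm2]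
    linear_combination ZMod.stdAddChar (2 : ZMod 8) * (h15 - h37)
  rw [sum_zmod_eight] at hrel
  change (((8 : ℕ) : ℂ)⁻¹ * ZMod.dft ν 0) • act (upper (M * ((0 : ℕ) : ℤ))) k +
    (((8 : ℕ) : ℂ)⁻¹ * ZMod.dft ν 1) • act (upper (M * ((1 : ℕ) : ℤ))) k +
    (((8 : ℕ) : ℂ)⁻¹ * ZMod.dft ν 2) • act (upper (M * ((2 : ℕ) : ℤ))) k +
    (((8 : ℕ) : ℂ)⁻¹ * ZMod.dft ν 3) • act (upper (M * ((3 : ℕ) : ℤ))) k +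
    (((8 : ℕ) : ℂ)⁻¹ * ZMod.dft ν 4) • act (upper (M * ((4 : ℕ) : ℤ))) k +
    (((8 : ℕ) : ℂ)⁻¹ * ZMod.dft ν 5) • act (upper (M * ((5 : ℕ) : ℤ))) k +
    (((8 : ℕ) : ℂ)⁻¹ * ZMod.dft ν 6) • act (upper (M * ((6 : ℕ) : ℤ))) k +
    (((8 : ℕ) : ℂ)⁻¹ * ZMod.dft ν 7) • act (upper (M * ((7 : ℕ) : ℤ))) k = 0 at hrel
  rw [e0, e2, e4, e6, Nat.cast_zero, mul_zero, mul_zero, upper_zero, act_one, zero_smul,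
    zero_smul] at hrel
  have key : k - act (upper (4 * M : ℕ)) k = (-(1 / 2 : ℂ)) •
      (ZMod.dft ν 1 • act (upper (M * ((1 : ℕ) : ℤ))) k +
      ZMod.dft ν 3 • act (upper (M * ((3 : ℕ) : ℤ))) k +
      ZMod.dft ν 5 • act (upper (M * ((5 : ℕ) : ℤ))) k +
      ZMod.dft ν 7 • act (upper (M * ((7 : ℕ) : ℤ))) k) := by
    rw [show ((4 * M : ℕ) : ℤ) = M * ((4 : ℕ) : ℤ) by push_cast; ring]
    funext τ
    have := congrFun hrel τ
    simp only [Pi.add_apply, Pi.smul_apply, smul_eq_mul, Pi.zero_apply, Nat.cast_ofNat] at this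
    simp only [Pi.sub_apply, Pi.add_apply, Pi.smul_apply, smul_eq_mul, Nat.cast_ofNat]
    linear_combination 4 * this
  rw [key]
  refine Submodule.smul_mem _ _ (add_mem (add_mem (add_mem ?_ ?_) ?_) ?_) <;>
    exact Submodule.smul_mem _ _ (hodd _ (by decide))

end IsEigen

/-! ### Primitivity of `χ_D` at every prime dividing `N` -/

lemma quadDisc_cases {N₁ : ℕ} (hs : Squarefree N₁) :
    ∃ c O : ℕ, quadDisc N₁ = c * O ∧ Odd O ∧ Squarefree O ∧
      (c = 1 ∧ N₁ % 4 = 1 ∨ c = 4 ∧ N₁ % 4 = 3 ∨ c = 8 ∧ N₁ % 4 = 2) := by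
  have h4 : N₁ % 4 ≠ 0 := fun h => by
    have := hs 2 (Nat.dvd_of_mod_eq_zero h)
    norm_num at this
  unfold quadDisc
  by_cases h1 : N₁ % 4 = 1
  · exact ⟨1, N₁, by simp [h1], by rw [Nat.odd_iff]; omega, hs, .inl ⟨rfl, h1⟩⟩
  rw [if_neg h1]
  by_cases h3 : N₁ % 4 = 3
  · exact ⟨4, N₁, rfl, by rw [Nat.odd_iff]; omega, hs, .inr (.inl ⟨rfl, h3⟩)⟩
  · refine ⟨8, N₁ / 2, by omega, by rw [Nat.odd_iff]; omega, ?_, .inr (.inr ⟨rfl, by omega⟩)⟩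
    exact hs.squarefree_of_dvd (Nat.div_dvd_of_dvd (by omega))

lemma kroneckerSym_of_odd (a m : ℕ) (hm : Odd m) :
    kroneckerSym (a : ℤ) (m : ℤ) = jacobiSym a m := by
  have hm0 : m ≠ 0 := by rintro rfl; simp at hm
  have h2 : m.factorization 2 = 0 :=
    Nat.factorization_eq_zero_of_not_dvd (by rw [← even_iff_two_dvd]; simpa using hm)
  simp [kroneckerSym, hm0, h2]

lemma exists_jacobiSym_eq_neg_one {p : ℕ} (hp : p.Prime) (hp2 : p ≠ 2) :
    ∃ r : ℕ, jacobiSym r p = -1 := by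
  have := Fact.mk hp
  obtain ⟨x, hx⟩ := quadraticChar_exists_neg_one (F := ZMod p) (by rwa [ZMod.ringChar_zmod_n])
  refine ⟨x.val, ?_⟩
  rw [← jacobiSym.legendreSym.to_jacobiSym, legendreSym]
  simpa using hx

/-- The witness is a nonresidue mod `l` that is `1` modulo `8` and modulo the rest of `O`.
Reciprocity carries no sign for it, and `2` is a square modulo it in the Jacobi sense, so only the
factor at `l` contributes. -/
lemma primitiveAt_odd {c O l : ℕ} (hO : Odd O) (hs : Squarefree O) (hc : c ∣ 8)
    (hl : l.Prime) (hlO : l ∣ O) (hl2 : l ≠ 2) {χ : ℤ → ℤ}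
    (hχ : ∀ m : ℕ, Odd m → χ m = jacobiSym (c * O : ℕ) m) : PrimitiveAt (c * O) χ l := by
  obtain ⟨r, hr⟩ := exists_jacobiSym_eq_neg_one hl hl2
  obtain ⟨O', rfl⟩ := hlO
  have hcop : Nat.Coprime l O' := Nat.coprime_of_squarefree_mul hs
  have hlo : Odd l := hl.odd_of_ne_two hl2
  have hcop8 : Nat.Coprime (8 * O') l := by
    refine Nat.Coprime.mul_left ?_ hcop.symm
    have : Nat.Coprime (2 ^ 3) l := Nat.Coprime.pow_left 3 (Nat.coprime_two_left.2 hlo)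
    exact this
  obtain ⟨m, hm1, hmr⟩ := Nat.chineseRemainder hcop8 1 r
  have hm8 : m % 8 = 1 := by
    have := hm1.of_mul_right O'
    exact this
  have hmodd : Odd m := by rw [Nat.odd_iff]; omega
  have hO'0 : O' ≠ 0 := by rintro rfl; simp at hO
  have hm1' : (m : ℤ) % O' = 1 % O' := by
    have := Nat.ModEq.of_mul_left 8 hm1
    exact_mod_cast this
  have hmr' : (m : ℤ) % l = r % l := by exact_mod_cast hmr
  have hJO : jacobiSym (l * O' : ℕ) m = -1 := by
    rw [jacobiSym.quadratic_reciprocity_one_mod_four' hO (by omega),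
      jacobiSym.mul_right' _ hl.ne_zero hO'0, jacobiSym.mod_left' hmr', hr,
      jacobiSym.mod_left' hm1', jacobiSym.one_left, mul_one]
  have hJ2 : jacobiSym 2 m = 1 := by
    rw [jacobiSym.at_two hmodd, ZMod.χ₈_nat_eq_if_mod_eight]
    simp [hm8]
    omega
  have hJc : jacobiSym c m = 1 := by
    obtain ⟨i, -, rfl⟩ := (Nat.dvd_prime_pow Nat.prime_two).1 (show c ∣ 2 ^ 3 from hc)
    rw [Nat.cast_pow, jacobiSym.pow_left, Nat.cast_ofNat, hJ2, one_pow]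
  refine ⟨m, ?_, ?_, ?_⟩
  · rw [ZMod.coe_int_isUnit_iff_isCoprime, Nat.isCoprime_iff_coprime]
    refine Nat.Coprime.mul_left ?_ ?_
    · have : Nat.Coprime (2 ^ 3) m := Nat.Coprime.pow_left 3 (Nat.coprime_two_left.2 hmodd)
      exact this.coprime_dvd_left hc
    · by_contra hne
      have hm0 : NeZero m := ⟨by rintro rfl; simp at hmodd⟩
      have := jacobiSym.eq_zero_iff_not_coprime.2 (show ((l * O' : ℕ) : ℤ).gcd m ≠ 1 from
        fun h1 => hne (by rwa [Int.gcd_natCast_natCast] at h1))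
      rw [this] at hJO
      norm_num at hJO
  · rw [hχ m hmodd, Nat.cast_mul, jacobiSym.mul_left, hJc, hJO, one_mul]
  · have h1 : ((8 * O' : ℕ) : ℤ) ∣ m - 1 := by
      have := (Nat.modEq_iff_dvd.1 hm1.symm)
      simpa using this
    refine (Int.natCast_dvd_natCast.2 ?_).trans h1
    rw [mul_left_comm, Nat.mul_div_cancel_left _ hl.pos]
    exact mul_dvd_mul_right hc O'

lemma primitiveAt_quadDisc {N₁ : ℕ} (hs : Squarefree N₁) {l : ℕ}
    (hl : l ∈ (quadDisc N₁).primeFactors) : PrimitiveAt (quadDisc N₁) (chiD N₁) l := by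
  obtain ⟨c, O, hN, hO, hsO, hc⟩ := quadDisc_cases hs
  have hχ : ∀ m : ℕ, Odd m → chiD N₁ m = jacobiSym (c * O : ℕ) m := fun m hm => by
    rw [chiD, kroneckerSym_of_odd _ _ hm, hN]
  rw [hN] at hl ⊢
  have hlp := Nat.prime_of_mem_primeFactors hl
  have hlN := Nat.dvd_of_mem_primeFactors hl
  have hc8 : c ∣ 8 := by rcases hc with h | h | h <;> rw [h.1] <;> decide
  by_cases hl2 : l = 2
  swap
  · refine primitiveAt_odd hO hsO hc8 hlp ?_ hl2 hχ
    refine Nat.Coprime.dvd_of_dvd_mul_left ?_ hlN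
    have : Nat.Coprime l (2 ^ 3) :=
      Nat.Coprime.pow_right 3 (Nat.coprime_two_right.2 (hlp.odd_of_ne_two hl2))
    exact this.coprime_dvd_right hc8
  subst hl2
  have hunit : ∀ d : ℕ, 2 ∣ d → IsUnit (((1 + d * O : ℕ) : ℤ) : ZMod (c * O)) := fun d hd => by
    rw [ZMod.coe_int_isUnit_iff_isCoprime, Nat.isCoprime_iff_coprime]
    refine Nat.Coprime.mul_left ?_ ?_
    · have : Nat.Coprime (2 ^ 3) (1 + d * O) := Nat.Coprime.pow_left 3
        (Nat.coprime_two_left.2 (by rw [Nat.odd_add]; simp [(even_iff_two_dvd.2 hd)]))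
      exact this.coprime_dvd_left hc8
    · simp
  have hmod : ∀ d : ℕ, ((1 + d * O : ℕ) : ℤ) % O = 1 % O := fun d => by push_cast; simp
  have hO2 := Nat.odd_iff.1 hO
  rcases hc with ⟨rfl, h⟩ | ⟨rfl, h⟩ | ⟨rfl, h⟩
  · rw [one_mul, ← even_iff_two_dvd, ← Nat.not_odd_iff_even] at hlN
    exact absurd hO hlN
  · have hO3 : O % 4 = 3 := by
      rw [quadDisc, if_neg (by omega)] at hN; omega
    -- The witness is `1 + N / 2`. Both it and `O` are `3` mod `4`, so reciprocity gives the sign.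
    refine ⟨(1 + 2 * O : ℕ), hunit 2 dvd_rfl, ?_, ?_⟩
    · have hodd : Odd (1 + 2 * O) := by rw [Nat.odd_iff]; omega
      rw [hχ _ hodd, Nat.cast_mul, jacobiSym.mul_left, Nat.cast_ofNat, jacobiSym.at_four hodd,
        jacobiSym.quadratic_reciprocity_three_mod_four hO3 (by omega), jacobiSym.mod_left' (hmod 2),
        jacobiSym.one_left]
      norm_num
    · have : 4 * O / 2 = 2 * O := by omega
      rw [this]; push_cast; simp
  · refine ⟨(1 + 4 * O : ℕ), hunit 4 (by decide), ?_, ?_⟩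
    · have hodd : Odd (1 + 4 * O) := by rw [Nat.odd_iff]; omega
      rw [hχ _ hodd, Nat.cast_mul, jacobiSym.mul_left,
        jacobiSym.quadratic_reciprocity_one_mod_four' hO (by omega), jacobiSym.mod_left' (hmod 4),
        jacobiSym.one_left, show ((8 : ℕ) : ℤ) = 4 * 2 by norm_num, jacobiSym.mul_left,
        jacobiSym.at_four hodd, jacobiSym.at_two hodd, ZMod.χ₈_nat_eq_if_mod_eight]
      have h5 : (1 + 4 * O) % 8 = 5 := by omega
      simp [h5]
      omega
    · have : 8 * O / 2 = 4 * O := by omega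
      rw [this]; push_cast; simp

/-! ### Rescaling -/

/-- The function `τ ↦ f(τ / N)`. -/
def rescale (N : ℕ) [NeZero N] (f : ℍ → ℂ) (τ : ℍ) : ℂ :=
  f ((⟨(N : ℝ)⁻¹, inv_pos.2 (Nat.cast_pos.2 (NeZero.pos N))⟩ : {x : ℝ // 0 < x}) • τ)

section rescale

variable {N : ℕ} [NeZero N] {f : ℍ → ℂ}

lemma rescale_ne_zero (hf : f ≠ 0) : rescale N f ≠ 0 := by
  intro h
  apply hf
  funext τ
  have := congrFun h ((⟨(N : ℝ)⁻¹, inv_pos.2 (Nat.cast_pos.2 (NeZero.pos N))⟩ :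
    {x : ℝ // 0 < x})⁻¹ • τ)
  rwa [rescale, smul_inv_smul] at this

lemma HasQExpansion.rescale {a : ℤ → ℂ} (h : HasQExpansion 1 f a) :
    HasQExpansion N (rescale N f) a := fun τ => by
  have hN : (N : ℂ) ≠ 0 := Nat.cast_ne_zero.2 (NeZero.ne N)
  rw [WeaklyHolomorphic.rescale]
  convert h ((⟨(N : ℝ)⁻¹, inv_pos.2 (Nat.cast_pos.2 (NeZero.pos N))⟩ : {x : ℝ // 0 < x}) • τ)
    using 4 with n
  rw [coe_pos_real_smul, Complex.real_smul]
  push_cast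
  field_simp

lemma mdifferentiable_rescale (hf : MDifferentiable 𝓘(ℂ) 𝓘(ℂ) f) :
    MDifferentiable 𝓘(ℂ) 𝓘(ℂ) (rescale N f) := by
  rw [UpperHalfPlane.mdifferentiable_iff] at hf ⊢
  have hN : (0 : ℝ) < (N : ℝ)⁻¹ := inv_pos.2 (Nat.cast_pos.2 (NeZero.pos N))
  have hmaps : Set.MapsTo (fun z : ℂ => ((N : ℝ)⁻¹ : ℝ) * z) {z : ℂ | 0 < z.im}
      {z : ℂ | 0 < z.im} := fun z hz => by
    rw [Set.mem_ofPred_eq, Complex.im_ofReal_mul]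
    exact mul_pos hN hz
  refine (hf.comp (by fun_prop) hmaps).congr fun z hz => ?_
  simp only [Function.comp_apply]
  rw [ofComplex_apply_of_im_pos hz, ofComplex_apply_of_im_pos (hmaps hz), WeaklyHolomorphic.rescale]
  congr 1

/-- Conjugation by the scaling sends `(a, b; c, d)` with `N ∣ b` to `(a, b / N; N c, d)` in Γ₀(N),
with the same `d`. -/
lemma isEigen_rescale {χ : ℤ → ℤ} (hf : f ≠ 0)
    (hslash : ∀ M ∈ CongruenceSubgroup.Gamma0 N, ∀ τ : ℍ,
      (f ∣[(0 : ℤ)] M) τ = (χ (M 1 1) : ℂ) * f τ) : IsEigen N χ (rescale N f) := by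
  refine ⟨rescale_ne_zero hf, fun M hM => ?_⟩
  obtain ⟨b, hb⟩ := hM
  have hdet := sl_det M
  let M' : SL(2, ℤ) := ⟨!![M 0 0, b; N * M 1 0, M 1 1], by
    rw [Matrix.det_fin_two_of]; rw [hb] at hdet; linarith⟩
  have hM' : M' ∈ CongruenceSubgroup.Gamma0 N := by
    rw [CongruenceSubgroup.Gamma0_mem]
    change ((N * M 1 0 : ℤ) : ZMod N) = 0
    simp
  funext τ
  have h1 := hslash M' hM' ((⟨(N : ℝ)⁻¹, inv_pos.2 (Nat.cast_pos.2 (NeZero.pos N))⟩ :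
    {x : ℝ // 0 < x}) • τ)
  rw [ModularForm.SL_slash_apply] at h1
  simp only [neg_zero, zpow_zero, mul_one] at h1
  rw [act_apply, Pi.smul_apply, smul_eq_mul, rescale, rescale]
  refine Eq.trans ?_ h1
  congr 1
  ext
  have e0 : M' 0 0 = M 0 0 := rfl
  have e1 : M' 0 1 = b := rfl
  have e2 : M' 1 0 = N * M 1 0 := rfl
  have e3 : M' 1 1 = M 1 1 := rfl
  have hN : (N : ℂ) ≠ 0 := Nat.cast_ne_zero.2 (NeZero.ne N)
  rw [coe_pos_real_smul, coe_specialLinearGroup_apply, coe_specialLinearGroup_apply,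
    coe_pos_real_smul, hb, e0, e1, e2, e3]
  simp only [eq_intCast, Complex.real_smul]
  push_cast
  have hden : (N : ℂ) * (M 1 0 : ℤ) * ((N : ℂ)⁻¹ * τ) + (M 1 1 : ℤ) =
      (M 1 0 : ℤ) * (τ : ℂ) + (M 1 1 : ℤ) := by
    field_simp
  rw [hden, ← mul_div_assoc]
  congr 1
  field_simp

end rescale

/-! ### The sign conditions as relations between translates -/

lemma jacobiSym_neg_one_eq (p : ℕ) : jacobiSym (-1) p = 1 ∨ jacobiSym (-1) p = -1 :=
  jacobiSym.eq_one_or_neg_one (by simp)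

lemma eps_two_eq {N₁ : ℕ} (h : N₁ % 4 = 2) :
    eps N₁ 2 = 1 ∨ eps N₁ 2 = -1 := by
  rw [eps, if_pos rfl, if_neg (by omega), chiM]
  refine Finset.prod_induction _ (fun x : ℤ => x = 1 ∨ x = -1) ?_ (.inl rfl) fun p hp => ?_
  · rintro a b (rfl | rfl) (rfl | rfl) <;> simp
  · have hp2 : p ≠ 2 := by
      rintro rfl
      have := Nat.dvd_of_mem_primeFactors hp
      omega
    rw [chiP, if_neg hp2]
    exact jacobiSym_neg_one_eq p

/-- The conditions on the coefficients at an odd prime `p` force `k` to be a combination of its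
translates by integers prime to `p`. -/
lemma IsEigen.mem_coprimeTranslates_odd {N₁ p : ℕ} [NeZero (quadDisc N₁)]
    (hs : Squarefree N₁) {k : ℍ → ℂ} {a : ℤ → ℂ} (h : IsEigen (quadDisc N₁) (chiD N₁) k)
    (hk : HasQExpansion (quadDisc N₁) k a)
    (ha : ∀ n : ℤ, Int.gcd n (quadDisc N₁ : ℤ) = 1 →
      (∃ p ∈ (quadDisc N₁).primeFactors, chiP N₁ p n = -eps N₁ p) → a n = 0)
    (hp : p ∈ (quadDisc N₁).primeFactors) (hp2 : p ≠ 2)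
    (hf : p ^ (quadDisc N₁).factorization p = p) :
    k ∈ coprimeTranslates p k := by
  classical
  have hpp := Nat.prime_of_mem_primeFactors hp
  have := Fact.mk hpp
  have hN : quadDisc N₁ = p * (quadDisc N₁ / p) :=
    (Nat.mul_div_cancel' (Nat.dvd_of_mem_primeFactors hp)).symm
  have hcop : Nat.Coprime p (quadDisc N₁ / p) := by
    have := Nat.coprime_ordCompl hpp (NeZero.ne (quadDisc N₁))
    rwa [hf] at this
  have heps : eps N₁ p = 1 ∨ eps N₁ p = -1 := by
    rw [eps, if_neg hp2, chiP, if_neg hp2]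
    exact jacobiSym_neg_one_eq p
  have hchi : ∀ n : ℤ, chiP N₁ p n = quadraticChar (ZMod p) n := fun n => by
    rw [chiP, if_neg hp2, ← jacobiSym.legendreSym.to_jacobiSym, legendreSym]
  -- The indicator of the classes where the coefficients must vanish; it is nonzero because `χ_p`
  -- takes both signs.
  set ν : ZMod p → ℂ := fun x => if quadraticChar (ZMod p) x = -eps N₁ p then 1 else 0 with hν
  refine mem_coprimeTranslates_of_relation hk hN hcop ν ?_ ?_
  · rw [hν, Finset.sum_boole, Nat.cast_ne_zero, Finset.card_ne_zero]
    rcases heps with he | he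
    · obtain ⟨x, hx⟩ := quadraticChar_exists_neg_one (F := ZMod p) (by rwa [ZMod.ringChar_zmod_n])
      exact ⟨x, Finset.mem_filter.2 ⟨Finset.mem_univ _, by rw [hx, he]⟩⟩
    · exact ⟨1, Finset.mem_filter.2 ⟨Finset.mem_univ _, by rw [map_one, he]; rfl⟩⟩
  · refine h.hasQExpansion_zero hk (fun l hl => primitiveAt_quadDisc hs hl) hp (fun n => ν n)
      ?_ ?_ ?_
    · intro n n' hnn
      rw [hf, ← ZMod.intCast_eq_intCast_iff_dvd_sub] at hnn
      rw [hnn]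
    · intro n hn
      rw [← ZMod.intCast_zmod_eq_zero_iff_dvd] at hn
      rcases heps with he | he <;> simp [hν, hn, he]
    · intro n hn
      by_cases hc : quadraticChar (ZMod p) n = -eps N₁ p
      · rw [ha n hn ⟨p, hp, (hchi n).trans hc⟩, mul_zero]
      · simp only [hν, if_neg hc, zero_mul]

/-- The conditions on the coefficients at `2` force `k - k(τ + N / 2)` to be a combination of the
translates of `k` by odd integers. -/
lemma IsEigen.sub_mem_coprimeTranslates_two {N₁ : ℕ} [NeZero (quadDisc N₁)]
    (hs : Squarefree N₁) {k : ℍ → ℂ} {a : ℤ → ℂ} (h : IsEigen (quadDisc N₁) (chiD N₁) k)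
    (hk : HasQExpansion (quadDisc N₁) k a)
    (ha : ∀ n : ℤ, Int.gcd n (quadDisc N₁ : ℤ) = 1 →
      (∃ p ∈ (quadDisc N₁).primeFactors, chiP N₁ p n = -eps N₁ p) → a n = 0)
    (hp : 2 ∈ (quadDisc N₁).primeFactors) {q M : ℕ} (hN : quadDisc N₁ = q * M) (hM : Odd M)
    (hf : 2 ^ (quadDisc N₁).factorization 2 = q)
    (hq : q = 4 ∧ N₁ % 4 = 3 ∨ q = 8 ∧ N₁ % 4 = 2) :
    k - act (upper (q / 2 * M : ℕ)) k ∈ coprimeTranslates 2 k := by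
  have main : ∀ ν : ZMod q → ℂ, (∀ x : ZMod q, ν (x + x) = 0) →
      (∀ n : ℤ, ν n ≠ 0 → chiP N₁ 2 n = -eps N₁ 2) →
      HasQExpansion (quadDisc N₁) 0 (fun n => ν n * a n) := by
    intro ν hν hν2
    refine h.hasQExpansion_zero hk (fun l hl => primitiveAt_quadDisc hs hl) hp (fun n => ν n)
      ?_ ?_ ?_
    · intro n n' hnn
      rw [hf, ← ZMod.intCast_eq_intCast_iff_dvd_sub] at hnn
      rw [hnn]
    · rintro _ ⟨x, rfl⟩
      have := hν x
      push_cast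
      rwa [two_mul]
    · intro n hn
      by_cases hc : ν n = 0
      · rw [hc, zero_mul]
      · rw [ha n hn ⟨2, hp, hν2 n hc⟩, mul_zero]
  rcases hq with ⟨rfl, hq⟩ | ⟨rfl, hq⟩
  · obtain ⟨ν, hν⟩ : ∃ ν : ZMod 4 → ℂ, ∀ x, ν x = if ZMod.χ₄ x = 1 then 1 else 0 :=
      ⟨_, fun _ => rfl⟩
    have hν0 : ∀ x : ZMod 4, ν (x + x) = 0 := fun x => by
      rw [hν, if_neg (by revert x; decide)]
    refine sub_mem_coprimeTranslates_four hk hN hM ν (hν0 0) (hν0 1) ?_ (main ν hν0 ?_)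
    · rw [hν, hν, if_pos (by decide), if_neg (by decide), add_zero]
    · intro n hn
      rw [chiP, eps, if_pos rfl, if_pos rfl, if_pos hq, if_pos hq, neg_neg]
      by_contra hc
      exact hn ((hν _).trans (if_neg hc))
  -- Both characters mod `8` vanish on even classes and change sign under adding `4`; nothing else
  -- about them is needed.
  · obtain ⟨X, hX, hX0, hXn⟩ : ∃ X : ZMod 8 → ℤ, (∀ n : ℤ, chiP N₁ 2 n = X n) ∧
        (∀ x, X (x + x) = 0) ∧ (∀ x, (X (x + x + 1) = 1 ∧ X (x + x + 5) = -1) ∨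
          (X (x + x + 1) = -1 ∧ X (x + x + 5) = 1)) := by
      by_cases h8 : N₁ % 8 = 2
      · exact ⟨ZMod.χ₈, fun n => by rw [chiP, if_pos rfl, if_neg (by omega), if_pos h8],
          by decide, by decide⟩
      · exact ⟨ZMod.χ₈', fun n => by rw [chiP, if_pos rfl, if_neg (by omega), if_neg h8],
          by decide, by decide⟩
    have he := eps_two_eq hq
    have h15 := hXn 0
    have h37 := hXn 1
    rw [show (0 + 0 + 1 : ZMod 8) = 1 by decide, show (0 + 0 + 5 : ZMod 8) = 5 by decide] at h15
    rw [show (1 + 1 + 1 : ZMod 8) = 3 by decide, show (1 + 1 + 5 : ZMod 8) = 7 by decide] at h37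
    obtain ⟨ν, hν⟩ : ∃ ν : ZMod 8 → ℂ, ∀ x, ν x = if X x = -eps N₁ 2 then 1 else 0 :=
      ⟨_, fun _ => rfl⟩
    have hν0 : ∀ x : ZMod 8, ν (x + x) = 0 := fun x => by
      rw [hν, hX0, if_neg]
      rcases he with he | he <;> rw [he] <;> decide
    refine sub_mem_coprimeTranslates_eight hk hN hM ν (hν0 0) (hν0 1) (hν0 2) (hν0 3) ?_ ?_
      (main ν hν0 ?_)
    · rw [hν, hν]
      rcases he with he | he <;> rcases h15 with h | h <;> rw [h.1, h.2, he] <;> norm_num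
    · rw [hν, hν]
      rcases he with he | he <;> rcases h37 with h | h <;> rw [h.1, h.2, he] <;> norm_num
    · intro n hn
      rw [hX]
      by_contra hc
      exact hn ((hν _).trans (if_neg hc))

/-- A witness of primitivity at `2` is `1 + n * x`. For even `x` it would be `1` mod `N`, with value
`1`; so `x` is odd and the witness is `1 + n` mod `N`. -/
lemma IsEigen.chi_one_add_half {N n : ℕ} {χ : ℤ → ℤ} {k : ℍ → ℂ} (h : IsEigen N χ k)
    (hn : N = 2 * n) (hχ : PrimitiveAt N χ 2) : χ (1 + n) = -1 := by
  obtain ⟨b, hbu, hχb, x, hx⟩ := hχ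
  rw [← hχb]
  have h2n : (2 * n : ZMod N) = 0 := by exact_mod_cast (ZMod.natCast_eq_zero_iff _ _).2 hn.dvd
  rw [hn, Nat.mul_div_cancel_left _ two_pos] at hx
  have hbx : (b : ZMod N) = 1 + n * x := by
    rw [show b = 1 + n * x by linarith]; push_cast; ring
  rcases Int.even_or_odd' x with ⟨y, rfl | rfl⟩
  · exfalso
    have : (b : ZMod N) = (1 : ℤ) := by
      rw [hbx]; push_cast; linear_combination (y : ZMod N) * h2n
    rw [h.chi_congr hbu this, h.chi_one] at hχb
    norm_num at hχb
  · symm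
    apply h.chi_congr hbu
    rw [hbx]; push_cast; linear_combination (y : ZMod N) * h2n

/-! ### Conclusion -/

/-- A form in `A^ε(N, 0, χ_D)` that is holomorphic at `∞` vanishes. -/
theorem eq_zero_of_holomorphicAtInfty {N₁ : ℕ} (h_one : 1 < N₁) (hs : Squarefree N₁) {f : ℍ → ℂ}
    (hol : MDifferentiable 𝓘(ℂ) 𝓘(ℂ) f)
    (hslash : ∀ M ∈ CongruenceSubgroup.Gamma0 (quadDisc N₁), ∀ τ : ℍ,
      (f ∣[(0 : ℤ)] M) τ = (chiD N₁ (M 1 1) : ℂ) * f τ)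
    {a : ℤ → ℂ} (hfa : HasQExpansion 1 f a)
    (ha : ∀ n : ℤ, Int.gcd n (quadDisc N₁ : ℤ) = 1 →
      (∃ p ∈ (quadDisc N₁).primeFactors, chiP N₁ p n = -eps N₁ p) → a n = 0)
    (hinf : HolomorphicAtInfty f) : f = 0 := by
  by_contra hf0
  have hN1 : 1 < quadDisc N₁ := by unfold quadDisc; split_ifs <;> omega
  have : NeZero (quadDisc N₁) := ⟨by omega⟩
  have h : IsEigen (quadDisc N₁) (chiD N₁) (rescale (quadDisc N₁) f) := isEigen_rescale hf0 hslash
  have hk : HasQExpansion (quadDisc N₁) (rescale (quadDisc N₁) f) a := hfa.rescale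
  -- The expansion without negative exponents serves only for boundedness, so it need not be
  -- compared with `a`.
  have hb : IsBoundedAtImInfty (rescale (quadDisc N₁) f) := by
    obtain ⟨b, hb, hb0⟩ := hinf
    exact isBoundedAtImInfty_of_hasQExpansion (NeZero.pos _) hb.rescale hb0
  have hkhol := mdifferentiable_rescale (N := quadDisc N₁) hol
  set k := rescale (quadDisc N₁) f
  have hex : ∀ p, ∃ E : ℤ, p ∈ (quadDisc N₁).primeFactors →
      ((p ^ (quadDisc N₁).factorization p : ℕ) : ℤ) ∣ E - 1 ∧
      ((quadDisc N₁ / p ^ (quadDisc N₁).factorization p : ℕ) : ℤ) ∣ E ∧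
      ((p ^ (quadDisc N₁).factorization p : ℕ) * E : ZMod (quadDisc N₁)) = 0 ∧
      ((quadDisc N₁ / p ^ (quadDisc N₁).factorization p : ℕ) * E : ZMod (quadDisc N₁)) =
        (quadDisc N₁ / p ^ (quadDisc N₁).factorization p : ℕ) ∧
      (E * E : ZMod (quadDisc N₁)) = E := fun p => by
    by_cases hp : p ∈ (quadDisc N₁).primeFactors
    · have hpp := Nat.prime_of_mem_primeFactors hp
      obtain ⟨E, hE⟩ := exists_idempotent (Nat.ordProj_mul_ordCompl_eq_self (quadDisc N₁) p).symm
        ((Nat.coprime_ordCompl hpp (NeZero.ne _)).pow_left _)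
      exact ⟨E, fun _ => hE⟩
    · exact ⟨0, fun h => absurd h hp⟩
  choose E hE using hex
  have hstable : ∀ γ, IsEigen.Stable k γ := by
    refine h.stable_of_partialInversion (NeZero.ne _) E (fun p hp => (hE p hp).1)
      (fun p hp => (hE p hp).2.1) (fun p hp => (hE p hp).2.2.2.2) fun p hp v hv => ?_
    have hpp := Nat.prime_of_mem_primeFactors hp
    have hpN := Nat.dvd_of_mem_primeFactors hp
    obtain ⟨hE1, hEM, hqE, hME, hEE⟩ := hE p hp
    have hv0 := hpp.factorization_pos_of_dvd (NeZero.ne (quadDisc N₁)) hpN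
    have hqM := (Nat.ordProj_mul_ordCompl_eq_self (quadDisc N₁) p).symm
    have hcop := Nat.coprime_ordCompl hpp (NeZero.ne (quadDisc N₁))
    have hq : p ^ (quadDisc N₁).factorization p ∣ p ^ (p ^ (quadDisc N₁).factorization p) :=
      pow_dvd_pow _ (Nat.lt_pow_self hpp.one_lt).le
    have hpq : p ∣ p ^ (quadDisc N₁).factorization p := dvd_pow_self p hv0.ne'
    obtain ⟨c, O, hN, hO, hsO, hc⟩ := quadDisc_cases hs
    have hc8 : c ∣ 2 ^ 3 := by rcases hc with h | h | h <;> (rw [h.1]; decide)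
    have hc0 : c ≠ 0 := by rintro rfl; simp at hc8
    have hO0 : O ≠ 0 := hsO.ne_zero
    by_cases hp2 : p = 2
    · subst hp2
      have hfac : 2 ^ (quadDisc N₁).factorization 2 = c := by
        rw [hN, Nat.factorization_mul hc0 hO0, Finsupp.add_apply,
          Nat.factorization_eq_zero_of_not_dvd (n := O) (by
            rw [← even_iff_two_dvd]; simpa using hO), add_zero]
        obtain ⟨i, -, rfl⟩ := (Nat.dvd_prime_pow Nat.prime_two).1 hc8
        rw [Nat.Prime.factorization_pow Nat.prime_two]
        simp
      have hc' : c = 4 ∧ N₁ % 4 = 3 ∨ c = 8 ∧ N₁ % 4 = 2 := by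
        rcases hc with h | h
        · rw [h.1] at hfac
          rw [hfac] at hpq
          omega
        · exact h
      have hM2 := Nat.coprime_two_left.1 hcop
      have hmem := h.sub_mem_coprimeTranslates_two hs hk ha hp hqM hM2 rfl (by rwa [hfac])
      have hc4 : 4 ∣ c := by omega
      rw [← hfac] at hc4
      have hn : quadDisc N₁ = 2 * (2 ^ (quadDisc N₁).factorization 2 / 2 *
          (quadDisc N₁ / 2 ^ (quadDisc N₁).factorization 2)) := by
        rw [← mul_assoc, Nat.mul_div_cancel' hpq, ← hqM]
      exact h.act_partialInversion_stable_two hqM hn (Dvd.dvd.mul_right (by omega) _)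
        (dvd_mul_left _ _) hq hpq hE1 hEM hqE hME hEE
        (h.chi_one_add_half hn (primitiveAt_quadDisc hs hp)) hmem hv
    · have hfac : p ^ (quadDisc N₁).factorization p = p := by
        have hpO : p ∣ O := by
          rw [hN] at hpN
          rcases (Nat.Prime.dvd_mul hpp).1 hpN with h1 | h1
          · exact absurd ((Nat.prime_dvd_prime_iff_eq hpp Nat.prime_two).1
              (hpp.dvd_of_dvd_pow (h1.trans hc8))) hp2
          · exact h1
        have h1 : c.factorization p = 0 := Nat.factorization_eq_zero_of_not_dvd fun h1 =>
          hp2 ((Nat.prime_dvd_prime_iff_eq hpp Nat.prime_two).1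
            (hpp.dvd_of_dvd_pow (h1.trans hc8)))
        have h2 : O.factorization p = 1 := le_antisymm (hsO.natFactorization_le_one p)
          (hpp.factorization_pos_of_dvd hO0 hpO)
        rw [hN, Nat.factorization_mul hc0 hO0, Finsupp.add_apply, h1, h2, zero_add, pow_one]
      exact h.act_partialInversion_stable_odd hpp hqM hq hpq hE1 hEM hEE
        (h.mem_coprimeTranslates_odd hs hk ha hp hp2 hfac) hv
  obtain ⟨c, hc⟩ := h.exists_eq_const hkhol fun γ => isBoundedAtImInfty_of_mem_translates hb
    (hstable γ k (by simpa using IsEigen.act_upper_mem k 0))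
  -- A matrix with eigenvalue `-1` fixes the constant `k`, so `k = -k`.
  obtain ⟨l, hl, hlN⟩ := Nat.exists_prime_and_dvd hN1.ne'
  obtain ⟨b, hbu, hχb, -⟩ := primitiveAt_quadDisc hs
    (Nat.mem_primeFactors.2 ⟨hl, hlN, NeZero.ne _⟩)
  obtain ⟨M, hM0, hM1⟩ := IsEigen.exists_matrix hbu
  have h1 := h.eig' M (hM1 ▸ dvd_rfl)
  have h2 : act M k = k := by rw [hc]; rfl
  rw [h2, hM0, hχb] at h1
  apply h.ne_zero
  funext τ
  have := congrFun h1 τ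
  simp only [Pi.smul_apply, Int.cast_neg, Int.cast_one, smul_eq_mul, neg_one_mul] at this
  exact self_eq_neg.1 this

lemma MemADelta.exists_sub {N₁ : ℕ} {δ : ℕ → ℤ} {f g : ℍ → ℂ} (hf : MemADelta N₁ 0 δ f)
    (hg : MemADelta N₁ 0 δ g) : ∃ a : ℤ → ℂ, HasQExpansion 1 (f - g) a ∧
      ∀ n : ℤ, Int.gcd n (quadDisc N₁ : ℤ) = 1 →
        (∃ p ∈ (quadDisc N₁).primeFactors, chiP N₁ p n = -δ p) → a n = 0 := by
  obtain ⟨a, ha, ha0⟩ := hf.condition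
  obtain ⟨b, hb, hb0⟩ := hg.condition
  exact ⟨_, ha.sub hb, fun n hn hp => by rw [ha0 n hn hp, hb0 n hn hp, sub_zero]⟩

end WeaklyHolomorphic

end

theorem mainTheorem8 (N₁ : ℕ) (h_one : 1 < N₁) (h_sqf : Squarefree N₁) :
    (∀ m : ℕ, 0 < m → ∀ f g : ℍ → ℂ,
      WeaklyHolomorphic.IsFm N₁ m f → WeaklyHolomorphic.IsFm N₁ m g → f = g) ∧
    (∀ f : ℍ → ℂ, WeaklyHolomorphic.MemADelta N₁ 0 (WeaklyHolomorphic.eps N₁) f →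
      WeaklyHolomorphic.HolomorphicAtInfty f → f = 0) := by
  refine ⟨fun m _ f g hf hg => ?_, fun f hf hinf => ?_⟩
  · obtain ⟨a, ha, ha0⟩ := hf.mem.exists_sub hg.mem
    refine sub_eq_zero.1 (WeaklyHolomorphic.eq_zero_of_holomorphicAtInfty h_one h_sqf
      (hf.mem.weaklyHolomorphic.holo.sub hg.mem.weaklyHolomorphic.holo) (fun M hM τ => ?_)
      ha ha0 ?_)
    · rw [show (f - g) ∣[(0 : ℤ)] M = f ∣[(0 : ℤ)] M - g ∣[(0 : ℤ)] M by
          rw [sub_eq_add_neg, SlashAction.add_slash, SlashAction.neg_slash, ← sub_eq_add_neg],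
        Pi.sub_apply, Pi.sub_apply, hf.mem.weaklyHolomorphic.slash M hM,
        hg.mem.weaklyHolomorphic.slash M hM, mul_sub]
    · obtain ⟨b, hb, hb0⟩ := hf.principalPart
      obtain ⟨b', hb', hb0'⟩ := hg.principalPart
      exact ⟨_, hb.sub hb', fun n hn => by rw [hb0 n hn, hb0' n hn, sub_self]⟩
  · obtain ⟨a, ha, ha0⟩ := hf.condition
    exact WeaklyHolomorphic.eq_zero_of_holomorphicAtInfty h_one h_sqf hf.weaklyHolomorphic.holo
      hf.weaklyHolomorphic.slash ha ha0 hinf
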